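/- **Setting.** Let $R$ be a regular local ring of dimension two with quotient field $K$, maximal ideal $\mathfrak m_R$ and residue field $\mathfrak k$. Let $\nu$ be a valuation of $K$ dominating $R$, with valuation ring $V_\nu$, maximal ideal $\mathfrak m_\nu$ and residue field $L=V_\nu/\mathfrak m_\nu$; write $[f]\in L$ for the class of $f\in V_\nu$. For elements $\beta_0,\dots,\beta_i$ of the value group let $G(\beta_0,\dots,\beta_i)$ be the subgroup that they generate. For a two-dimensional regular local ring $A$ with quotient field $K$ dominated by $\nu$, the quadratic transform of $A$ along $\nu$ is $A[\frac vu]_{A[\frac vu]\cap\mathfrak m_\nu}$, where $u,v$ are regular parameters of $A$ with $\nu(u)\le\nu(v)$. Let $R=T_0\to T_1\to T_2\to\cdots$ be the sequence of quadratic transforms along $\nu$ (continued constantly if it reaches a ring that is no longer two-dimensional). **The algorithm's conclusions.** Let $A$ be a local ring with quotient field $K$ dominated by $\nu$, with residue field $\mathfrak k_A\subseteq L$. Let $\Omega\in\mathbb Z_{+}\cup\{\infty\}$, let $P_i$ ($0\le i\le\Omega$, $i<\infty$) be nonzero elements of $\mathfrak m_A$, and put $\overline n_i=[G(\nu(P_0),\dots,\nu(P_i)):G(\nu(P_0),\dots,\nu(P_{i-1}))]$.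 We say that the $P_i$, with positive integers $n_i$ ($1\le i<\Omega$) and monomials $U_i=P_0^{w_0(i)}\cdots P_{i-1}^{w_{i-1}(i)}$ ($w_j(i)\in\mathbb N$, and $w_j(i)<n_j$ for $1\le j\le i-1$) with $\nu(P_i^{\overline n_i})=\nu(U_i)$, given for all $1\le i\le\Omega$ with $\overline n_i<\infty$, *satisfy the conclusions of the algorithm for $A$* if the following hold, where $\alpha_i=[P_i^{\overline n_i}/U_i]$ if $\overline n_i<\infty$ and $\alpha_i=1$ if $\overline n_i=\infty$. (a) For $1\le i<\Omega$ there are $\lambda_i\ge1$, units $c_k$ of $A$ and $\sigma_{i,s}(k)\in\mathbb N$ with $\sigma_{i,s}(k)<n_s$ for $1\le s\le i$ such that $$P_{i+1}=P_i^{n_i}+\sum_{k=1}^{\lambda_i}c_kP_0^{\sigma_{i,0}(k)}\cdots P_i^{\sigma_{i,i}(k)},\qquad n_i\nu(P_i)=\nu\big(P_0^{\sigma_{i,0}(k)}\cdots P_i^{\sigma_{i,i}(k)}\big)\text{ for all }k,$$ and $\nu(P_{i+1})>n_i\nu(P_i)$. Further, $\overline n_i$ divides every $\sigma_{i,i}(k)$,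 $n_i=\overline n_id_i$ with $d_i\in\mathbb Z_+$, and for $0\le t<d_i$ $$b_{i,t}=\Big[\sum_{\sigma_{i,i}(k)=t\overline n_i}c_k\frac{P_0^{\sigma_{i,0}(k)}\cdots P_{i-1}^{\sigma_{i,i-1}(k)}}{U_i^{d_i-t}}\Big]$$ lies in $\mathfrak k_A(\alpha_1,\dots,\alpha_{i-1})$, and $u^{d_i}+b_{i,d_i-1}u^{d_i-1}+\cdots+b_{i,0}$ is the minimal polynomial of $\alpha_i$ over $\mathfrak k_A(\alpha_1,\dots,\alpha_{i-1})$. (b) For $0\le r<\Omega$: if $M_1,\dots,M_m$ are monomials in $P_0,\dots,P_r$ with distinct exponent vectors, with exponents of $P_s$ less than $n_s$ for $1\le s\le r$, and all of the same value, then $1,[M_2/M_1],\dots,[M_m/M_1]$ are linearly independent over $\mathfrak k_A$. (c) If $\Omega<\infty$, then either $\overline n_\Omega=\infty$, or $\overline n_\Omega<\infty$ and $[\mathfrak k_A(\alpha_1,\dots,\alpha_\Omega):\mathfrak k_A(\alpha_1,\dots,\alpha_{\Omega-1})]=\infty$. **Theorem 7.1.** Let $x,y$ be regular parameters of $R$,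 and let $P_0=x$, $P_1=y$, $P_2,\dots$ with $\Omega$, $n_i$, $U_i$ satisfy the conclusions of the algorithm for $R$. Suppose that $\Omega\ge2$. Then there is a smallest $i\ge1$ such that the divisor of $xy$ in $\operatorname{Spec}(T_i)$ has only one component. Let $R_1=T_i$; it is dominated by $\nu$. Then the natural map $R_1/\mathfrak m_{R_1}\to L$ induces an isomorphism $R_1/\mathfrak m_{R_1}\cong\mathfrak k(\alpha_1)$. There exist $x_1\in R_1$ and $w\in\mathbb Z_+$ such that $x_1=0$ is a local equation of the (reduced) exceptional divisor of $\operatorname{Spec}(R_1)\to\operatorname{Spec}(R)$, the ring $R_1$ is regular local of dimension two, and $Q_0=x_1$ and $Q_1=P_2/x_1^{wn_1}$ are regular parameters of $R_1$. Moreover, the elements $Q_0$ and $$Q_i=\frac{P_{i+1}}{Q_0^{wn_1\cdots n_i}}\qquad(1\le i<\Omega)$$ satisfy the conclusions of the algorithm for $R_1$, with $\Omega-1$ in place of $\Omega$ (where $\infty-1=\infty$), with $n_{i+1}$ in place of $n_i$, and with suitable monomials in place of the $U_i$. -/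

import Mathlib

namespace GenSeq

variable {K : Type*} [Field K] {Γ₀ : Type*} [LinearOrderedCommGroupWithZero Γ₀]

/-! ### Valuations, regular parameters, quadratic transforms

Valuations are written multiplicatively: `ν f ≤ ν g` below is `ν(f) ≥ ν(g)` additively.
All rings birational to `R` are realised as subrings of the field `K`. -/

/-- `ν` dominates the ring `A`: `A ⊆ V_ν`, and `m_ν ∩ A` is the set of non-units of `A`. -/
def Dominates (ν : Valuation K Γ₀) (A : Subring K) : Prop :=
  ∀ a : A, ν (a : K) ≤ 1 ∧ (ν (a : K) < 1 ↔ a ∈ nonunits A)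

/-- `A` is a regular local ring of dimension two, and `u, v` generate its maximal ideal. -/
def IsRegularParameters (A : Subring K) (u v : K) : Prop :=
  ∃ (_ : IsRegularLocalRing A) (hu : u ∈ A) (hv : v ∈ A), ringKrullDim A = 2 ∧
    Ideal.span {(⟨u, hu⟩ : A), ⟨v, hv⟩} = IsLocalRing.maximalIdeal A

/-- The localization of `A` at the center of `ν`, as a subring of `K`: all `f / g` with
`f, g ∈ A` and `ν g = 1` (for `A ⊆ V_ν` this says that `g ∉ A ∩ m_ν`). -/
def localizationAtCenter (ν : Valuation K Γ₀) (A : Subring K) : Subring K where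
  carrier := {z | ∃ f ∈ A, ∃ g ∈ A, ν g = 1 ∧ z = f / g}
  zero_mem' := ⟨0, A.zero_mem, 1, A.one_mem, map_one ν, by simp⟩
  one_mem' := ⟨1, A.one_mem, 1, A.one_mem, map_one ν, by simp⟩
  mul_mem' := by
    rintro _ _ ⟨f, hf, g, hg, hν, rfl⟩ ⟨f', hf', g', hg', hν', rfl⟩
    exact ⟨f * f', A.mul_mem hf hf', g * g', A.mul_mem hg hg', by rw [map_mul, hν, hν', one_mul],
      by rw [div_mul_div_comm]⟩
  neg_mem' := by
    rintro _ ⟨f, hf, g, hg, hν, rfl⟩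
    exact ⟨-f, A.neg_mem hf, g, hg, hν, by rw [neg_div]⟩
  add_mem' := by
    rintro _ _ ⟨f, hf, g, hg, hν, rfl⟩ ⟨f', hf', g', hg', hν', rfl⟩
    have hg0 : g ≠ 0 := fun h => by simp [h] at hν
    have hg0' : g' ≠ 0 := fun h => by simp [h] at hν'
    exact ⟨f * g' + g * f', A.add_mem (A.mul_mem hf hg') (A.mul_mem hg hf'), g * g',
      A.mul_mem hg hg', by rw [map_mul, hν, hν', one_mul], by rw [div_add_div _ _ hg0 hg0']⟩

/-- `B` is the quadratic transform of the two-dimensional regular local ring `A` along `ν`: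
`B` is the localization of `A[v/u]` at the center of `ν`, for regular parameters `u, v` of `A`
with (additively) `ν(u) ≤ ν(v)`. -/
def IsQuadraticTransform (ν : Valuation K Γ₀) (A B : Subring K) : Prop :=
  ∃ u v : K, IsRegularParameters A u v ∧ ν v ≤ ν u ∧
    B = localizationAtCenter ν (Subring.closure ((A : Set K) ∪ {v / u}))

open Classical in
/-- The quadratic transform of `A` along `ν`. If `A` is not a two-dimensional regular local ring
(which happens in the sequence below once it has reached `V_ν`, for divisorial `ν`), then `A`
itself. -/
noncomputable def quadraticTransform (ν : Valuation K Γ₀) (A : Subring K) : Subring K :=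
  if h : ∃ B, IsQuadraticTransform ν A B then h.choose else A

/-- The sequence `R = T 0 → T 1 → T 2 → ⋯` of quadratic transforms along `ν`. -/
noncomputable def quadraticSeq (ν : Valuation K Γ₀) (R : Subring K) : ℕ → Subring K
  | 0 => R
  | i + 1 => quadraticTransform ν (quadraticSeq ν R i)

/-- The divisor of `f` in `Spec A` has exactly one irreducible component. -/
def DivisorHasOneComponent (A : Subring K) (f : K) : Prop :=
  ∃ hf : f ∈ A, ∃! p : Ideal A, p ∈ (Ideal.span {(⟨f, hf⟩ : A)}).minimalPrimes

/-- `z = 0` is a local equation in `B` of the (reduced) exceptional divisor of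
`Spec B → Spec A`, the preimage of the closed point of `Spec A`. -/
def IsExceptionalEquation (A B : Subring K) (z : K) : Prop :=
  ∃ (_ : IsLocalRing A) (hAB : A ≤ B) (hz : z ∈ B),
    Ideal.span {(⟨z, hz⟩ : B)} =
      ((IsLocalRing.maximalIdeal A).map (Subring.inclusion hAB)).radical

/-! ### The data attached to a sequence `P 0, P 1, …` of elements of `K` -/

/-- The residue field `L = V_ν / m_ν`. -/
abbrev ResField (ν : Valuation K Γ₀) : Type _ := IsLocalRing.ResidueField ν.valuationSubring

open Classical in
/-- The class `[f] ∈ L` of an element `f` of `V_ν` (and `0` if `f ∉ V_ν`). -/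
noncomputable def resid (ν : Valuation K Γ₀) (f : K) : ResField ν :=
  if h : ν f ≤ 1 then IsLocalRing.residue ν.valuationSubring ⟨f, h⟩ else 0

/-- The monomial `P 0 ^ e 0 * ⋯ * P (m - 1) ^ e (m - 1)`. -/
def monomial (P : ℕ → K) (m : ℕ) (e : ℕ → ℕ) : K := ∏ s ∈ Finset.range m, P s ^ e s

/-- `G(ν(P 0), …, ν(P i))`, the subgroup of the value group generated by these values. -/
def valueGroup (ν : Valuation K Γ₀) (P : ℕ → K) (i : ℕ) : Subgroup Γ₀ˣ :=
  Subgroup.closure {g | ∃ j ≤ i, (g : Γ₀) = ν (P j)}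

/-- The index `n̄ i = [G(ν(P 0), …, ν(P i)) : G(ν(P 0), …, ν(P (i - 1)))]` for `i ≥ 1`,
where the value `0` stands for an infinite index. -/
noncomputable def nbar (ν : Valuation K Γ₀) (P : ℕ → K) (i : ℕ) : ℕ :=
  (valueGroup ν P (i - 1)).relIndex (valueGroup ν P i)

/-- `U i = P 0 ^ w i 0 * ⋯ * P (i - 1) ^ w i (i - 1)`. -/
def U (P : ℕ → K) (w : ℕ → ℕ → ℕ) (i : ℕ) : K := monomial P i (w i)

/-- `α i = [P i ^ n̄ i / U i]`, and `α i = 1` if `n̄ i` is infinite. -/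
noncomputable def alpha (ν : Valuation K Γ₀) (P : ℕ → K) (w : ℕ → ℕ → ℕ) (i : ℕ) : ResField ν :=
  if nbar ν P i = 0 then 1 else resid ν (P i ^ nbar ν P i / U P w i)

/-- The residue field of `A` as a subfield of `L`, for a local ring `A` dominated by `ν`. -/
noncomputable def baseField (ν : Valuation K Γ₀) (A : Subring K) : Subfield (ResField ν) :=
  Subfield.closure (resid ν '' A)

/-- The subfield `𝔨(α 1, …, α i)` of `L`, where `𝔨` is the residue field of `A`. -/
noncomputable def towerField (ν : Valuation K Γ₀) (A : Subring K) (P : ℕ → K) (w : ℕ → ℕ → ℕ)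
    (i : ℕ) : Subfield (ResField ν) :=
  baseField ν A ⊔ Subfield.closure {a | ∃ j, 1 ≤ j ∧ j ≤ i ∧ a = alpha ν P w j}

/-! ### The conclusions of the algorithm -/

open Polynomial in
/-- What the algorithm asserts about the step from `P i` to `P (i + 1)`, for `1 ≤ i < Ω`. The
coefficients `c k` are units of the ring `A`. -/
def IsStep (ν : Valuation K Γ₀) (A : Subring K) (P : ℕ → K) (n : ℕ → ℕ) (w : ℕ → ℕ → ℕ)
    (i : ℕ) : Prop :=
  1 ≤ n i ∧
  ∃ (lam : ℕ) (c : Fin lam → K) (σ : Fin lam → ℕ → ℕ) (d : ℕ)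
    (b : ℕ → towerField ν A P w (i - 1)),
    -- the expression of `P (i + 1)`
    1 ≤ lam ∧
    (∀ k, ∃ hc : c k ∈ A, IsUnit (⟨c k, hc⟩ : A)) ∧
    P (i + 1) = P i ^ n i + ∑ k, c k * monomial P (i + 1) (σ k) ∧
    (∀ k s, 1 ≤ s → s ≤ i → σ k s < n s) ∧
    (∀ k, ν (P i ^ n i) = ν (monomial P (i + 1) (σ k))) ∧
    -- the value of `P (i + 1)` is larger (additively) than `n i` times that of `P i`
    ν (P (i + 1)) < ν (P i) ^ n i ∧
    -- divisibility by `n̄ i`, and `n i = n̄ i * d i`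
    (∀ k, nbar ν P i ∣ σ k i) ∧
    1 ≤ d ∧ n i = nbar ν P i * d ∧
    -- the minimal polynomial of `α i` over `𝔨(α 1, …, α (i - 1))`
    (∀ t < d, (b t : ResField ν) =
      resid ν (∑ k with σ k i = t * nbar ν P i, c k * (monomial P i (σ k) / U P w i ^ (d - t)))) ∧
    minpoly (towerField ν A P w (i - 1)) (alpha ν P w i) =
      X ^ d + ∑ t ∈ Finset.range d, C (b t) * X ^ t

/-- The classes of distinct monomials of equal value in `P 0, …, P r`, with exponents of `P s`
smaller than `n s` for `1 ≤ s ≤ r`, divided by the first of them, are linearly independent over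
the residue field of `A`. -/
def MonomialsIndependent (ν : Valuation K Γ₀) (A : Subring K) (P : ℕ → K) (n : ℕ → ℕ)
    (r : ℕ) : Prop :=
  ∀ (m : ℕ) (j : Fin (m + 1) → ℕ → ℕ),
    (∀ l s, 1 ≤ s → s ≤ r → j l s < n s) →
    (∀ l l', l ≠ l' → ∃ s ≤ r, j l s ≠ j l' s) →
    (∀ l, ν (monomial P (r + 1) (j l)) = ν (monomial P (r + 1) (j 0))) →
    LinearIndependent (baseField ν A)
      (fun l => resid ν (monomial P (r + 1) (j l) / monomial P (r + 1) (j 0)))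

/-- The sequence `P i`, `0 ≤ i ≤ Ω` (`i` finite), with the exponents `n i` (`1 ≤ i < Ω`) and the
exponents `w i` of the monomials `U i`, satisfies the conclusions of the algorithm for the local
ring `A` dominated by `ν`. Nothing is asked of `P i` for `i > Ω`. -/
structure SatisfiesAlgorithm (ν : Valuation K Γ₀) (A : Subring K) (P : ℕ → K) (Ω : ℕ∞)
    (n : ℕ → ℕ) (w : ℕ → ℕ → ℕ) : Prop where
  one_le : 1 ≤ Ω
  mem : ∀ i : ℕ, (i : ℕ∞) ≤ Ω → P i ≠ 0 ∧ ∃ h : P i ∈ A, (⟨P i, h⟩ : A) ∈ nonunits A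
  step : ∀ i : ℕ, 1 ≤ i → (i : ℕ∞) < Ω → IsStep ν A P n w i
  independent : ∀ r : ℕ, (r : ℕ∞) < Ω → MonomialsIndependent ν A P n r
  /-- `U i` has the value of `P i ^ n̄ i` whenever `n̄ i` is finite, which is so for `i < Ω`. -/
  value_U : ∀ i : ℕ, 1 ≤ i → (i : ℕ∞) ≤ Ω → nbar ν P i ≠ 0 →
    (∀ j, 1 ≤ j → j < i → w i j < n j) ∧ ν (P i ^ nbar ν P i) = ν (U P w i)
  /-- If `Ω` is finite then `n̄ Ω = ∞`, or `n̄ Ω < ∞` and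
  `[𝔨(α 1, …, α Ω) : 𝔨(α 1, …, α (Ω - 1))] = ∞` (Mathlib's `relfinrank` is `0` for an extension
  of infinite degree). If `Ω = ∞`, then by `step` all these indices and degrees are finite. -/
  terminates : ∀ N : ℕ, Ω = N → nbar ν P N = 0 ∨
    (nbar ν P N ≠ 0 ∧
      (towerField ν A P w (N - 1)).relfinrank (towerField ν A P w N) = 0)

/-- `Q 0 = x₁` and `Q i = P (i + 1) / x₁ ^ (e * n 1 * ⋯ * n i)` for `i ≥ 1`. -/
noncomputable def transformSeq (P : ℕ → K) (n : ℕ → ℕ) (x₁ : K) (e : ℕ) : ℕ → K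
  | 0 => x₁
  | i + 1 => P (i + 2) / x₁ ^ (e * ∏ j ∈ Finset.Icc 1 (i + 1), n j)

end GenSeq

open GenSeq

/-! Idea of the proof, with values written additively. Put q = n̄_1 and U_1 = x^p, so that qν(y) =
pν(x). Then p and q are coprime, since a common factor would lower the index n̄_1. The element s =
y^q/x^p has value zero and residue class α_1, of degree d over 𝔨, and n_1 = qd. As long as the two
regular parameters have different values, a quadratic transform only divides one by the other. The
sequence therefore runs Euclid's algorithm on (p, q), leaving s unchanged, up to a ring T with
regular parameters x₁ and x₁s, where x = x₁^q s^k and y = x₁^p s^l. Up to T both parameters divide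
xy, so its divisor has two components (`exists_quadraticSeq_isRegularParameters`).

The next transform is T[s], localized. It adjoins α_1 to the residue field, makes s a unit, and has
regular parameters x₁ and F(s) for any monic F lifting the minimal polynomial of α_1
(`IsRegularParameters.blowUp`). There xy is a power of x₁ times a unit. The expression of P_2 gives
P_2 = x^(pd) F(s) (`exists_monic_eq_mul_aeval`), so P_2/x₁^(p n_1) is F(s) times a unit, and w = p.

A monomial in P_0, …, P_{r+1} is a power of s times a power of x₁ times a monomial in Q_1, …, Q_r.
The jumps ν(P_{i+1}) > n_i ν(P_i) pass to the Q_i, so ν(Q_{r+1}) exceeds the value of every monomial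
in Q_1, …, Q_r with bounded exponents. Hence the monomials in a step relation carry enough powers of
x₁ for the relation to be divided by the right one (`mul_order_lt_monomialOrder`). The powers of s
go into the coefficients, which become units of R_1, and each α_i is multiplied by a power of α_1.
So value groups and residue fields are the old ones shifted by one, and minimal polynomials are
rescaled (`isStep_transformSeq`). Independence over 𝔨(α_1) reduces to independence over 𝔨:
multiplying a monomial in the Q_i by 1, s, …, s^(d-1) and a high power of x₁ gives, up to a power of
s, d distinct monomials in the P_i (`monomialsIndependent_transformSeq`). -/

namespace GenSeq

variable {K : Type*} [Field K] {Γ₀ : Type*} [LinearOrderedCommGroupWithZero Γ₀]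
  {ν : Valuation K Γ₀}

/-! ### Residue classes -/

theorem resid_of_le {f : K} (h : ν f ≤ 1) :
    resid ν f = IsLocalRing.residue ν.valuationSubring ⟨f, h⟩ := dif_pos h

theorem resid_add {f g : K} (hf : ν f ≤ 1) (hg : ν g ≤ 1) :
    resid ν (f + g) = resid ν f + resid ν g := by
  rw [resid_of_le hf, resid_of_le hg, resid_of_le (ν.map_add_le hf hg), ← map_add]
  rfl

theorem resid_mul {f g : K} (hf : ν f ≤ 1) (hg : ν g ≤ 1) :
    resid ν (f * g) = resid ν f * resid ν g := by
  have h : ν (f * g) ≤ 1 := by rw [map_mul]; exact mul_le_one' hf hg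
  rw [resid_of_le hf, resid_of_le hg, resid_of_le h, ← map_mul]
  rfl

@[simp] theorem resid_one : resid ν (1 : K) = 1 := by
  rw [resid_of_le (by simp : ν (1 : K) ≤ 1)]
  exact map_one (IsLocalRing.residue ν.valuationSubring)

@[simp] theorem resid_zero : resid ν (0 : K) = 0 := by
  rw [resid_of_le (by simp : ν (0 : K) ≤ 1)]
  exact map_zero (IsLocalRing.residue ν.valuationSubring)

theorem resid_eq_zero_iff {f : K} (hf : ν f ≤ 1) : resid ν f = 0 ↔ ν f < 1 := by
  rw [resid_of_le hf, IsLocalRing.residue_eq_zero_iff]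
  have := Valuation.Integers.isUnit_iff_valuation_eq_one (Valuation.valuationSubring.integers ν)
    (x := ⟨f, hf⟩)
  rw [IsLocalRing.mem_maximalIdeal, mem_nonunits_iff, this]
  exact ⟨fun h => lt_of_le_of_ne hf h, fun h => h.ne⟩

theorem resid_ne_zero {f : K} (hf : ν f = 1) : resid ν f ≠ 0 := by
  rw [Ne, resid_eq_zero_iff hf.le, hf]; exact lt_irrefl _

theorem resid_inv {f : K} (hf : ν f = 1) : resid ν f⁻¹ = (resid ν f)⁻¹ := by
  have h0 : f ≠ 0 := fun h => by simp [h] at hf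
  have hi : ν f⁻¹ = 1 := by rw [map_inv₀, hf, inv_one]
  refine eq_inv_of_mul_eq_one_left ?_
  rw [← resid_mul hi.le hf.le, inv_mul_cancel₀ h0, resid_one]

theorem resid_pow {f : K} (hf : ν f ≤ 1) (k : ℕ) : resid ν (f ^ k) = resid ν f ^ k := by
  induction k with
  | zero => simp
  | succ k ih =>
    rw [pow_succ, resid_mul (by rw [map_pow]; exact pow_le_one' hf k) hf, ih, pow_succ]

theorem resid_zpow {f : K} (hf : ν f = 1) (k : ℤ) : resid ν (f ^ k) = resid ν f ^ k := by
  cases k with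
  | ofNat k => simpa using resid_pow hf.le k
  | negSucc k =>
    rw [zpow_negSucc, zpow_negSucc, resid_inv (by rw [map_pow, hf, one_pow]), resid_pow hf.le]

theorem resid_sum {ι : Type*} (S : Finset ι) (f : ι → K) (hf : ∀ i ∈ S, ν (f i) ≤ 1) :
    resid ν (∑ i ∈ S, f i) = ∑ i ∈ S, resid ν (f i) := by
  classical
  induction S using Finset.induction_on with
  | empty => simp
  | insert a S ha ih =>
    rw [Finset.sum_insert ha, Finset.sum_insert ha,
      resid_add (hf a (Finset.mem_insert_self a S))
        (ν.map_sum_le fun i hi => hf i (Finset.mem_insert_of_mem hi)),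
      ih fun i hi => hf i (Finset.mem_insert_of_mem hi)]

/-- The residue map on a subring of the valuation ring. -/
noncomputable def residHom (ν : Valuation K Γ₀) (A : Subring K) (h : ∀ a : A, ν (a : K) ≤ 1) :
    A →+* ResField ν where
  toFun a := resid ν (a : K)
  map_one' := resid_one
  map_zero' := resid_zero
  map_add' a b := resid_add (h a) (h b)
  map_mul' a b := resid_mul (h a) (h b)

/-! ### Dominated rings -/

namespace Dominates

variable {A : Subring K} (hA : Dominates ν A)
include hA

theorem le_one {a : K} (ha : a ∈ A) : ν a ≤ 1 := (hA ⟨a, ha⟩).1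

theorem isUnit_iff (a : A) : IsUnit a ↔ ν (a : K) = 1 := by
  have h := hA a
  rw [mem_nonunits_iff] at h
  constructor
  · intro hu
    by_contra hne
    exact h.2.1 (lt_of_le_of_ne h.1 hne) hu
  · intro h1
    by_contra hne
    exact (h.2.2 hne).ne h1

theorem inv_mem {a : K} (ha : a ∈ A) (h1 : ν a = 1) : a⁻¹ ∈ A := by
  obtain ⟨u, hu⟩ := (hA.isUnit_iff ⟨a, ha⟩).2 h1
  have h : a * ((↑u⁻¹ : A) : K) = 1 := by
    have h := congrArg (Subtype.val) u.mul_inv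
    rw [hu] at h
    exact h
  rw [inv_eq_of_mul_eq_one_right h]
  exact (↑u⁻¹ : A).2

theorem zpow_mem {a : K} (ha : a ∈ A) (h1 : ν a = 1) (k : ℤ) : a ^ k ∈ A := by
  cases k with
  | ofNat k => simpa using A.pow_mem ha k
  | negSucc k => rw [zpow_negSucc, ← inv_pow]; exact A.pow_mem (hA.inv_mem ha h1) _

theorem isLocalRing : IsLocalRing A := by
  have : Nontrivial A := inferInstance
  refine IsLocalRing.of_nonunits_add fun a b ha hb => ?_
  rw [← (hA _).2] at ha hb ⊢
  exact ν.map_add_lt ha hb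

theorem mem_maximalIdeal [IsLocalRing A] (a : A) :
    a ∈ IsLocalRing.maximalIdeal A ↔ ν (a : K) < 1 := by
  rw [IsLocalRing.mem_maximalIdeal, (hA a).2]

/-- The residue map of a dominated ring. -/
noncomputable def resHom : A →+* ResField ν := residHom ν A fun a => (hA a).1

omit hA in
@[simp] theorem resHom_apply (hA : Dominates ν A) (a : A) : hA.resHom a = resid ν (a : K) := rfl

/-- The image of `A` is already a field: elements of value one have their inverse in `A`, and all
others have class zero. -/
theorem mem_baseField {a : ResField ν} : a ∈ baseField ν A ↔ ∃ f ∈ A, resid ν f = a := by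
  let F : Subfield (ResField ν) :=
    { hA.resHom.range with
      inv_mem' := by
        rintro _ ⟨f, rfl⟩
        by_cases h0 : ν (f : K) < 1
        · refine ⟨0, ?_⟩
          have hf0 : hA.resHom f = 0 := (resid_eq_zero_iff (hA f).1).2 h0
          rw [hf0, inv_zero, map_zero]
        · have h1 : ν (f : K) = 1 := le_antisymm (hA f).1 (not_lt.1 h0)
          exact ⟨⟨(f : K)⁻¹, hA.inv_mem f.2 h1⟩, resid_inv h1⟩ }
  have hF : baseField ν A = F := by
    apply le_antisymm
    · rw [baseField, Subfield.closure_le]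
      rintro _ ⟨f, hf, rfl⟩
      exact ⟨⟨f, hf⟩, rfl⟩
    · rintro _ ⟨f, rfl⟩
      exact Subfield.subset_closure ⟨f, f.2, rfl⟩
  rw [hF]
  constructor
  · rintro ⟨f, rfl⟩
    exact ⟨f, f.2, rfl⟩
  · rintro ⟨f, hf, rfl⟩
    exact ⟨⟨f, hf⟩, rfl⟩

end Dominates

theorem resid_mem_baseField (ν : Valuation K Γ₀) {A : Subring K} {f : K} (hf : f ∈ A) :
    resid ν f ∈ baseField ν A := Subfield.subset_closure ⟨f, hf, rfl⟩

/-! ### Localization at the center -/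

theorem le_localizationAtCenter (C : Subring K) : C ≤ localizationAtCenter ν C :=
  fun f hf => ⟨f, hf, 1, C.one_mem, map_one ν, by simp⟩

theorem dominates_localizationAtCenter {C : Subring K} (hC : ∀ f ∈ C, ν f ≤ 1) :
    Dominates ν (localizationAtCenter ν C) := by
  rintro ⟨_, f, hf, g, hg, hν, rfl⟩
  have hv : ν (f / g) = ν f := by rw [map_div₀, hν, div_one]
  have hg0 : g ≠ 0 := fun h => by simp [h] at hν
  have hle : ν (f / g) ≤ 1 := by rw [hv]; exact hC f hf
  refine ⟨hle, ?_⟩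
  rw [mem_nonunits_iff]
  constructor
  · rintro hlt ⟨u, hu⟩
    have h := congrArg (fun z : localizationAtCenter ν C => ν (z : K)) u.mul_inv
    simp only [hu, Subring.coe_mul, map_mul, Subring.coe_one, map_one] at h
    obtain ⟨f', hf', g', hg', hν', he⟩ := (↑u⁻¹ : localizationAtCenter ν C).2
    have : ν ((↑u⁻¹ : localizationAtCenter ν C) : K) ≤ 1 := by
      rw [he, map_div₀, hν', div_one]; exact hC f' hf'
    exact (mul_lt_one_of_lt_of_le hlt this).ne h
  · intro hu
    by_contra hlt
    have h1 : ν f = 1 := le_antisymm (hC f hf) (by rw [← hv]; exact not_lt.1 hlt)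
    have hf0 : f ≠ 0 := fun h => by simp [h] at h1
    apply hu
    refine IsUnit.of_mul_eq_one (⟨g / f, g, hg, f, hf, h1, rfl⟩ : localizationAtCenter ν C) ?_
    apply Subtype.ext
    change f / g * (g / f) = 1
    field_simp

theorem localizationAtCenter_le {C B : Subring K} (hB : Dominates ν B) (h : C ≤ B) :
    localizationAtCenter ν C ≤ B := by
  rintro _ ⟨f, hf, g, hg, hν, rfl⟩
  rw [div_eq_mul_inv]
  exact B.mul_mem (h hf) (hB.inv_mem (h hg) hν)

/-- The ring `A[s]`, localized at the center of `ν`. -/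
abbrev blowUp (ν : Valuation K Γ₀) (A : Subring K) (s : K) : Subring K :=
  localizationAtCenter ν (Subring.closure ((A : Set K) ∪ {s}))

theorem le_one_of_mem_closure {A : Subring K} (hA : Dominates ν A) {s : K} (hs : ν s ≤ 1) {f : K}
    (hf : f ∈ Subring.closure ((A : Set K) ∪ {s})) : ν f ≤ 1 := by
  have : Subring.closure ((A : Set K) ∪ {s}) ≤ ν.valuationSubring.toSubring := by
    rw [Subring.closure_le]
    rintro z (hz | rfl)
    · exact hA.le_one hz
    · exact hs
  exact this hf

theorem dominates_blowUp {A : Subring K} (hA : Dominates ν A) {s : K} (hs : ν s ≤ 1) :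
    Dominates ν (blowUp ν A s) :=
  dominates_localizationAtCenter fun _ hf => le_one_of_mem_closure hA hs hf

theorem le_blowUp (A : Subring K) (s : K) : A ≤ blowUp ν A s := fun _ hf =>
  le_localizationAtCenter _ (Subring.subset_closure (Or.inl hf))

theorem mem_blowUp (A : Subring K) (s : K) : s ∈ blowUp ν A s :=
  le_localizationAtCenter _ (Subring.subset_closure (Or.inr rfl))

theorem blowUp_le {A B : Subring K} {s : K} (hB : Dominates ν B) (hA : A ≤ B) (hs : s ∈ B) :
    blowUp ν A s ≤ B := by
  apply localizationAtCenter_le hB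
  rw [Subring.closure_le]
  rintro z (hz | rfl)
  · exact hA hz
  · exact hs

theorem mem_closure_iff {A : Subring K} {s z : K} :
    z ∈ Subring.closure ((A : Set K) ∪ {s}) ↔
      ∃ G : Polynomial A, Polynomial.aeval s G = z := by
  constructor
  · intro hz
    have : Subring.closure ((A : Set K) ∪ {s}) ≤
        (Polynomial.aeval s : Polynomial A →ₐ[A] K).toRingHom.range := by
      rw [Subring.closure_le]
      rintro z (hz | rfl)
      · exact ⟨Polynomial.C ⟨z, hz⟩, Polynomial.aeval_C _ _⟩
      · exact ⟨Polynomial.X, by simp⟩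
    exact this hz
  · rintro ⟨G, rfl⟩
    have hs : s ∈ Subring.closure ((A : Set K) ∪ {s}) := Subring.subset_closure (Or.inr rfl)
    rw [Polynomial.aeval_eq_sum_range]
    refine Subring.sum_mem _ fun i _ => ?_
    rw [Algebra.smul_def]
    exact Subring.mul_mem _ (Subring.subset_closure (Or.inl (G.coeff i).2))
      (pow_mem hs _)

/-! ### Quadratic transforms -/

namespace IsRegularParameters

variable {A : Subring K} {u v : K}

theorem symm (h : IsRegularParameters A u v) : IsRegularParameters A v u := by
  obtain ⟨h1, hu, hv, h2, h3⟩ := h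
  exact ⟨h1, hv, hu, h2, by rw [Set.pair_comm, h3]⟩

theorem lt_one (h : IsRegularParameters A u v) (hA : Dominates ν A) : ν u < 1 := by
  obtain ⟨h1, hu, hv, h2, h3⟩ := h
  exact (hA.mem_maximalIdeal ⟨u, hu⟩).1 (h3 ▸ Ideal.subset_span (by simp))

theorem exists_eq (h : IsRegularParameters A u v) (hA : Dominates ν A) {z : K} (hz : z ∈ A)
    (hz1 : ν z < 1) : ∃ a ∈ A, ∃ b ∈ A, z = a * u + b * v := by
  obtain ⟨h1, hu, hv, h2, h3⟩ := h
  have := (hA.mem_maximalIdeal ⟨z, hz⟩).2 hz1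
  rw [← h3, Ideal.mem_span_pair] at this
  obtain ⟨a, b, hab⟩ := this
  exact ⟨a, a.2, b, b.2, (congrArg Subtype.val hab).symm⟩

theorem mem_left (h : IsRegularParameters A u v) : u ∈ A := h.2.1

theorem mem_right (h : IsRegularParameters A u v) : v ∈ A := h.2.2.1

theorem left_ne_zero (h : IsRegularParameters A u v) : u ≠ 0 := by
  obtain ⟨h1, hu, hv, h2, h3⟩ := h
  rintro rfl
  have h4 : IsLocalRing.maximalIdeal A = Ideal.span {⟨v, hv⟩} := by
    rw [← h3, Ideal.span_insert]
    simp only [sup_eq_right]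
    rw [Ideal.span_le, Set.singleton_subset_iff]
    exact Ideal.zero_mem _
  have h5 := Ideal.height_le_one_of_isPrincipal_of_mem_minimalPrimes
    (Ideal.span {(⟨v, hv⟩ : A)}) (IsLocalRing.maximalIdeal A) (by
      rw [← h4, Ideal.minimalPrimes_eq_subsingleton_self]; rfl)
  have h6 := IsLocalRing.maximalIdeal_height_eq_ringKrullDim (R := A)
  rw [h2] at h6
  have h7 : (IsLocalRing.maximalIdeal A).height = 2 :=
    WithBot.coe_injective h6
  rw [h7] at h5
  exact absurd h5 (by decide)

end IsRegularParameters

/-- The transform does not depend on the chosen parameters. Both `u` and `u'` have the least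
additive value on the maximal ideal, so `u' / u` is a unit of the blow-up, and `v' / u'` lies in it.
-/
theorem blowUp_le_blowUp {A : Subring K} (hA : Dominates ν A) {u v u' v' : K}
    (h : IsRegularParameters A u v) (h' : IsRegularParameters A u' v') (hle : ν v ≤ ν u)
    (hle' : ν v' ≤ ν u') : blowUp ν A (v' / u') ≤ blowUp ν A (v / u) := by
  have hval : ∀ {u v z : K}, IsRegularParameters A u v → ν v ≤ ν u → z ∈ A → ν z < 1 →
      ν z ≤ ν u := by
    intro u v z h hle hz hz1
    obtain ⟨a, ha, b, hb, rfl⟩ := h.exists_eq hA hz hz1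
    refine ν.map_add_le ?_ ?_
    · rw [map_mul]; exact mul_le_of_le_one_left' (hA.le_one ha)
    · rw [map_mul]; exact (mul_le_of_le_one_left' (hA.le_one hb)).trans hle
  have hu0 := h.left_ne_zero
  have hu0' := h'.left_ne_zero
  have hν0 : 0 < ν u := (Valuation.pos_iff ν).2 hu0
  have hs : ν (v / u) ≤ 1 := by rw [map_div₀]; exact div_le_one_of_le₀ hle zero_le
  have hdom := dominates_blowUp hA hs
  have hdiv : ∀ {z : K}, z ∈ A → ν z < 1 → z / u ∈ blowUp ν A (v / u) := by
    intro z hz hz1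
    obtain ⟨a, ha, b, hb, rfl⟩ := h.exists_eq hA hz hz1
    have : (a * u + b * v) / u = a + b * (v / u) := by field_simp
    rw [this]
    exact Subring.add_mem _ (le_blowUp A _ ha)
      (Subring.mul_mem _ (le_blowUp A _ hb) (mem_blowUp A _))
  have heq : ν u' = ν u := le_antisymm (hval h hle h'.mem_left (h'.lt_one hA))
    (hval h' hle' h.mem_left (h.lt_one hA))
  have h1 : ν (u' / u) = 1 := by rw [map_div₀, heq, div_self hν0.ne']
  refine blowUp_le hdom (le_blowUp A _) ?_
  have : v' / u' = (v' / u) * (u' / u)⁻¹ := by field_simp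
  rw [this]
  exact Subring.mul_mem _ (hdiv h'.mem_right (h'.symm.lt_one hA))
    (hdom.inv_mem (hdiv h'.mem_left (h'.lt_one hA)) h1)

theorem quadraticTransform_eq {A : Subring K} (hA : Dominates ν A) {u v : K}
    (h : IsRegularParameters A u v) (hle : ν v ≤ ν u) :
    quadraticTransform ν A = blowUp ν A (v / u) := by
  have hex : ∃ B, IsQuadraticTransform ν A B := ⟨_, u, v, h, hle, rfl⟩
  rw [quadraticTransform, dif_pos hex]
  obtain ⟨u', v', h', hle', he⟩ := hex.choose_spec
  rw [he]
  exact le_antisymm (blowUp_le_blowUp hA h h' hle hle') (blowUp_le_blowUp hA h' h hle' hle)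

theorem quadraticSeq_succ' (A : Subring K) (i : ℕ) :
    quadraticSeq ν A (i + 1) = quadraticSeq ν (quadraticTransform ν A) i := by
  induction i with
  | zero => rfl
  | succ i ih =>
    change quadraticTransform ν (quadraticSeq ν A (i + 1)) = _
    rw [ih]; rfl

end GenSeq

namespace GenSeq

/-! ### Two-dimensional regular local rings -/

section CommRing

variable {A : Type*} [CommRing A]

/-- By Krull's height theorem the maximal ideal 𝔪 is not minimal over `u`, so another prime p
contains `u`, and p omits `v`. If au + bv ∈ p then b ∈ p; hence p ⊆ (u) + 𝔪p, and Nakayama gives p =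
(u). -/
theorem isPrime_span_of_span_pair_eq_maximalIdeal [IsLocalRing A] [IsNoetherianRing A]
    (hdim : ringKrullDim A = 2) {u v : A}
    (h : Ideal.span {u, v} = IsLocalRing.maximalIdeal A) :
    (Ideal.span {u}).IsPrime ∧ v ∉ Ideal.span {u} := by
  have hht : (IsLocalRing.maximalIdeal A).height = 2 := by
    have h6 := IsLocalRing.maximalIdeal_height_eq_ringKrullDim (R := A)
    rw [hdim] at h6
    exact WithBot.coe_injective h6
  have hu : u ∈ IsLocalRing.maximalIdeal A := h ▸ Ideal.subset_span (by simp)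
  obtain ⟨p, hp, hup, hpm⟩ : ∃ p : Ideal A, p.IsPrime ∧ u ∈ p ∧
      p ≠ IsLocalRing.maximalIdeal A := by
    by_contra! hcon
    have hmin : IsLocalRing.maximalIdeal A ∈ (Ideal.span {u}).minimalPrimes := by
      refine ⟨⟨inferInstance, ?_⟩, ?_⟩
      · rwa [Ideal.span_singleton_le_iff_mem]
      · rintro q ⟨hq, hle⟩ -
        rw [hcon q hq (hle (Ideal.mem_span_singleton_self u))]
    have h5 := Ideal.height_le_one_of_isPrincipal_of_mem_minimalPrimes _ _ hmin
    rw [hht] at h5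
    exact absurd h5 (by decide)
  have hv : v ∉ p := fun hv => hpm (le_antisymm (IsLocalRing.le_maximalIdeal hp.ne_top) (by
    rw [← h, Ideal.span_le]
    rintro z (rfl | rfl)
    exacts [hup, hv]))
  have hle : p ≤ Ideal.span {u} ⊔ IsLocalRing.maximalIdeal A • p := by
    intro z hz
    have hzm := IsLocalRing.le_maximalIdeal hp.ne_top hz
    rw [← h, Ideal.mem_span_pair] at hzm
    obtain ⟨a, b, rfl⟩ := hzm
    have hbv : b * v ∈ p := by
      have := p.sub_mem hz (p.mul_mem_left a hup)
      rwa [add_sub_cancel_left] at this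
    refine Submodule.add_mem_sup (Ideal.mul_mem_left _ _ (Ideal.mem_span_singleton_self u)) ?_
    rw [mul_comm]
    exact Submodule.smul_mem_smul (h ▸ Ideal.subset_span (by simp))
      ((hp.mem_or_mem hbv).resolve_right hv)
  have hle' := Submodule.le_of_le_smul_of_le_jacobson_bot (IsNoetherian.noetherian p)
    (IsLocalRing.maximalIdeal_le_jacobson ⊥) hle
  have heq : p = Ideal.span {u} :=
    le_antisymm hle' (by rwa [Ideal.span_singleton_le_iff_mem])
  rw [← heq]
  exact ⟨hp, hv⟩

/-- Modulo the prime (u) the coefficient of the top power of `v` vanishes. Writing it as uh and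
moving hv into the neighbouring coefficient leaves a relation divisible by `u`, of lower degree. -/
theorem mem_of_homogeneous_sum_eq_zero [IsDomain A] {m : Ideal A} {u v : A} (hu0 : u ≠ 0)
    (hu : (Ideal.span {u}).IsPrime) (hv : v ∉ Ideal.span {u}) (hum : u ∈ m) (hvm : v ∈ m) (n : ℕ) :
    ∀ g : ℕ → A, ∑ i ∈ Finset.range (n + 1), g i * (v ^ i * u ^ (n - i)) = 0 →
      ∀ i ≤ n, g i ∈ m := by
  induction n with
  | zero =>
    intro g hg i hi
    obtain rfl : i = 0 := by omega
    have : g 0 = 0 := by simpa using hg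
    rw [this]; exact m.zero_mem
  | succ n ih =>
    intro g hg
    rw [Finset.sum_range_succ] at hg
    have hS : ∑ i ∈ Finset.range (n + 1), g i * (v ^ i * u ^ (n + 1 - i)) =
        u * ∑ i ∈ Finset.range (n + 1), g i * (v ^ i * u ^ (n - i)) := by
      rw [Finset.mul_sum]
      refine Finset.sum_congr rfl fun i hi => ?_
      have : n + 1 - i = (n - i) + 1 := by have := Finset.mem_range.1 hi; omega
      rw [this, pow_succ]; ring
    rw [hS, Nat.sub_self, pow_zero, mul_one] at hg
    have hmem : g (n + 1) * v ^ (n + 1) ∈ Ideal.span {u} := by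
      rw [Ideal.mem_span_singleton]
      exact ⟨-∑ i ∈ Finset.range (n + 1), g i * (v ^ i * u ^ (n - i)), by linear_combination hg⟩
    have hg1 : g (n + 1) ∈ Ideal.span {u} :=
      (hu.mem_or_mem hmem).resolve_right fun h => hv (hu.mem_of_pow_mem _ h)
    obtain ⟨h, hh⟩ := Ideal.mem_span_singleton.1 hg1
    have key := ih (fun i => if i = n then g n + h * v else g i) (by
      rw [Finset.sum_range_succ] at hg ⊢
      rw [if_pos rfl, Finset.sum_congr rfl (g := fun i => g i * (v ^ i * u ^ (n - i)))
        (fun i hi => by rw [if_neg (Finset.mem_range.1 hi).ne])]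
      rw [hh] at hg
      rw [Nat.sub_self, pow_zero] at hg ⊢
      apply mul_left_cancel₀ hu0
      linear_combination hg)
    intro i hi
    rcases Nat.lt_or_ge n i with hlt | hle
    · obtain rfl : i = n + 1 := by omega
      rw [hh]; exact m.mul_mem_right _ hum
    · have := key i hle
      by_cases hin : i = n
      · subst hin
        rw [if_pos rfl] at this
        have h2 := m.sub_mem this (m.mul_mem_left h hvm)
        rwa [add_sub_cancel_right] at h2
      · rwa [if_neg hin] at this

end CommRing

variable {K : Type*} [Field K] {Γ₀ : Type*} [LinearOrderedCommGroupWithZero Γ₀]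
  {ν : Valuation K Γ₀} {A : Subring K} {u v : K}

namespace IsRegularParameters

theorem isPrime_span (h : IsRegularParameters A u v) :
    (Ideal.span {(⟨u, h.mem_left⟩ : A)}).IsPrime ∧
      (⟨v, h.mem_right⟩ : A) ∉ Ideal.span {(⟨u, h.mem_left⟩ : A)} := by
  obtain ⟨h1, hu, hv, h2, h3⟩ := h
  exact isPrime_span_of_span_pair_eq_maximalIdeal h2 h3

theorem coeff_lt_one_of_aeval_eq_zero (h : IsRegularParameters A u v) (hA : Dominates ν A)
    (G : Polynomial A) (hG : Polynomial.aeval (v / u) G = 0) (i : ℕ) :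
    ν (G.coeff i : K) < 1 := by
  have := hA.isLocalRing
  rw [← hA.mem_maximalIdeal]
  rcases Nat.lt_or_ge G.natDegree i with hlt | hle
  · rw [Polynomial.coeff_eq_zero_of_natDegree_lt hlt]; exact Ideal.zero_mem _
  have hu0 := h.left_ne_zero
  let u' : A := ⟨u, h.mem_left⟩
  let v' : A := ⟨v, h.mem_right⟩
  have hu0' : u' ≠ 0 := fun h0 => hu0 (congrArg Subtype.val h0)
  have hsum : ∑ j ∈ Finset.range (G.natDegree + 1),
      G.coeff j * (v' ^ j * u' ^ (G.natDegree - j)) = 0 := by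
    apply Subtype.ext
    rw [AddSubmonoidClass.coe_finsetSum, ZeroMemClass.coe_zero,
      ← mul_zero (u ^ G.natDegree), ← hG, Polynomial.aeval_eq_sum_range, Finset.mul_sum]
    refine Finset.sum_congr rfl fun j hj => ?_
    obtain ⟨k, hk⟩ : ∃ k, G.natDegree = j + k :=
      Nat.exists_eq_add_of_le (by have := Finset.mem_range.1 hj; omega)
    have hcoe : ((G.coeff j * (v' ^ j * u' ^ (G.natDegree - j)) : A) : K) =
        (G.coeff j : K) * (v ^ j * u ^ k) := by
      rw [hk, Nat.add_sub_cancel_left]; rfl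
    have hsmul : G.coeff j • (v / u) ^ j = (G.coeff j : K) * (v / u) ^ j := rfl
    rw [hcoe, hsmul, hk, div_pow, pow_add]
    field_simp
  exact mem_of_homogeneous_sum_eq_zero hu0' h.isPrime_span.1 h.isPrime_span.2
    ((hA.mem_maximalIdeal u').2 (h.lt_one hA)) ((hA.mem_maximalIdeal v').2 (h.symm.lt_one hA))
    G.natDegree G.coeff hsum i hle

/-- Apply au + bv = u(a + b·v/u) to each coefficient. -/
theorem exists_eq_mul_of_coeff_lt_one (h : IsRegularParameters A u v) (hA : Dominates ν A)
    (H : Polynomial A) (hH : ∀ i, ν (H.coeff i : K) < 1) :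
    ∃ r ∈ Subring.closure ((A : Set K) ∪ {v / u}), Polynomial.aeval (v / u) H = u * r := by
  have hu0 := h.left_ne_zero
  have hAc : A ≤ Subring.closure ((A : Set K) ∪ {v / u}) :=
    fun a ha => Subring.subset_closure (Or.inl ha)
  have hsc : v / u ∈ Subring.closure ((A : Set K) ∪ {v / u}) :=
    Subring.subset_closure (Or.inr rfl)
  choose a ha b hb hab using fun i => h.exists_eq hA (H.coeff i).2 (hH i)
  refine ⟨∑ i ∈ Finset.range (H.natDegree + 1), (a i + b i * (v / u)) * (v / u) ^ i,
    Subring.sum_mem _ fun i _ => Subring.mul_mem _ (Subring.add_mem _ (hAc (ha i))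
      (Subring.mul_mem _ (hAc (hb i)) hsc)) (pow_mem hsc i), ?_⟩
  rw [Polynomial.aeval_eq_sum_range, Finset.mul_sum]
  refine Finset.sum_congr rfl fun i _ => ?_
  rw [Algebra.smul_def]
  change (H.coeff i : K) * _ = _
  rw [hab i]
  field_simp

end IsRegularParameters

theorem isNoetherianRing_localizationAtCenter {C : Subring K} [IsNoetherianRing C] :
    IsNoetherianRing (localizationAtCenter ν C) := by
  refine (isNoetherianRing_iff_ideal_fg _).2 fun I => ?_
  let ι : C →+* localizationAtCenter ν C := Subring.inclusion (le_localizationAtCenter C)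
  have hI : I = Ideal.map ι (Ideal.comap ι I) := by
    refine le_antisymm ?_ Ideal.map_comap_le
    rintro ⟨_, f, hf, g, hg, hν, rfl⟩ hz
    have hg0 : g ≠ 0 := fun h => by simp [h] at hν
    have hfI : (⟨f, hf⟩ : C) ∈ Ideal.comap ι I := by
      rw [Ideal.mem_comap]
      have := I.mul_mem_left (ι ⟨g, hg⟩) hz
      convert this using 1
      apply Subtype.ext
      change f = g * (f / g)
      field_simp
    have := (Ideal.map ι (Ideal.comap ι I)).mul_mem_left
      (⟨1 / g, 1, C.one_mem, g, hg, hν, rfl⟩ : localizationAtCenter ν C)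
      (Ideal.mem_map_of_mem ι hfI)
    convert this using 1
    apply Subtype.ext
    change f / g = 1 / g * f
    field_simp
  rw [hI]
  exact Ideal.FG.map ((isNoetherianRing_iff_ideal_fg C).1 inferInstance _) ι

theorem isNoetherianRing_closure [IsNoetherianRing A] (s : K) :
    IsNoetherianRing (Subring.closure ((A : Set K) ∪ {s})) := by
  let φ : Polynomial A →+* Subring.closure ((A : Set K) ∪ {s}) :=
    (Polynomial.aeval s : Polynomial A →ₐ[A] K).toRingHom.codRestrict _
      fun G => mem_closure_iff.2 ⟨G, rfl⟩
  refine isNoetherianRing_of_surjective _ _ φ ?_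
  rintro ⟨z, hz⟩
  obtain ⟨G, hG⟩ := mem_closure_iff.1 hz
  exact ⟨G, Subtype.ext hG⟩

open Polynomial in
/-- The quadratic transform is regular of dimension two; here `F` lifts the minimal polynomial of
the residue class of `v / u`. -/
theorem IsRegularParameters.blowUp (h : IsRegularParameters A u v) (hA : Dominates ν A)
    (hle : ν v ≤ ν u) (F : Polynomial A) (hF : F.Monic) (hF1 : ν (aeval (v / u) F) < 1)
    (hmin : ∀ G : Polynomial A, G.natDegree < F.natDegree → ν (aeval (v / u) G) < 1 →
      ∀ i, ν (G.coeff i : K) < 1) :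
    IsRegularParameters (GenSeq.blowUp ν A (v / u)) u (aeval (v / u) F) := by
  set s := v / u with hs
  have hu0 := h.left_ne_zero
  have hν0 : 0 < ν u := (Valuation.pos_iff ν).2 hu0
  have hs1 : ν s ≤ 1 := by rw [hs, map_div₀]; exact div_le_one_of_le₀ hle zero_le
  set B := GenSeq.blowUp ν A s with hB
  have hdom : Dominates ν B := dominates_blowUp hA hs1
  have hloc := hdom.isLocalRing
  have hCB : Subring.closure ((A : Set K) ∪ {s}) ≤ B := le_localizationAtCenter _
  have hmemC : ∀ G : Polynomial A, aeval s G ∈ Subring.closure ((A : Set K) ∪ {s}) :=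
    fun G => mem_closure_iff.2 ⟨G, rfl⟩
  have hCle : ∀ G : Polynomial A, ν (aeval s G) ≤ 1 := fun G => hdom.le_one (hCB (hmemC G))
  have huB : u ∈ B := le_blowUp A s h.mem_left
  have hFB : aeval s F ∈ B := hCB (hmemC F)
  have hAnoeth : IsNoetherianRing A := by obtain ⟨h1, -⟩ := h; infer_instance
  have := isNoetherianRing_closure (A := A) s
  have hnoeth : IsNoetherianRing B := isNoetherianRing_localizationAtCenter
  have hFne : F ≠ 1 := by
    rintro rfl
    simp at hF1
  have hspan : Ideal.span {(⟨u, huB⟩ : B), ⟨aeval s F, hFB⟩} = IsLocalRing.maximalIdeal B := by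
    apply le_antisymm
    · rw [Ideal.span_le]
      rintro z (rfl | rfl)
      · exact (hdom.mem_maximalIdeal _).2 (h.lt_one hA)
      · exact (hdom.mem_maximalIdeal _).2 hF1
    · rintro ⟨z, hz⟩ hzm
      rw [hdom.mem_maximalIdeal] at hzm
      obtain ⟨f, hf, g, hg, hg1, rfl⟩ := hz
      have hf1 : ν f < 1 := by simpa [map_div₀, hg1] using hzm
      obtain ⟨G, rfl⟩ := mem_closure_iff.1 hf
      -- The remainder has degree below that of `F`, so `hmin` puts its coefficients in the maximal
      -- ideal of `A` and its value at `s` is a multiple of `u`.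
      have hdiv := modByMonic_add_div G F
      have hev : aeval s G = aeval s (G %ₘ F) + aeval s F * aeval s (G /ₘ F) := by
        rw [← map_mul, ← map_add, hdiv]
      have hrem : ν (aeval s (G %ₘ F)) < 1 := by
        have : aeval s (G %ₘ F) = aeval s G - aeval s F * aeval s (G /ₘ F) := by
          rw [hev]; ring
        rw [this]
        refine ν.map_sub_lt hf1 ?_
        rw [map_mul]
        exact mul_lt_one_of_lt_of_le hF1 (hCle _)
      obtain ⟨r, hr, hre⟩ := h.exists_eq_mul_of_coeff_lt_one hA _
        (hmin _ (natDegree_modByMonic_lt G hF hFne) hrem)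
      have hginv : g⁻¹ ∈ B := hdom.inv_mem (hCB hg) hg1
      rw [Ideal.mem_span_pair]
      refine ⟨⟨r * g⁻¹, B.mul_mem (hCB hr) hginv⟩,
        ⟨aeval s (G /ₘ F) * g⁻¹, B.mul_mem (hCB (hmemC _)) hginv⟩, Subtype.ext ?_⟩
      change r * g⁻¹ * u + aeval s (G /ₘ F) * g⁻¹ * aeval s F = aeval s G / g
      rw [hev, hre, div_eq_mul_inv]
      ring
  have hdim2 : 2 ≤ ringKrullDim B := by
    by_contra hlt
    have hle1 : ringKrullDim B ≤ 1 := by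
      rw [← IsLocalRing.maximalIdeal_height_eq_ringKrullDim] at hlt ⊢
      have h2 : (IsLocalRing.maximalIdeal B).height < 2 := by
        by_contra h2
        exact hlt (WithBot.coe_le_coe.2 (not_lt.1 h2))
      exact WithBot.coe_le_coe.2 (Order.le_of_lt_add_one (by simpa [one_add_one_eq_two] using h2))
    have hK : Ring.KrullDimLE 1 B := Ring.krullDimLE_iff.2 (by exact_mod_cast hle1)
    -- In dimension at most one, every prime containing `u ≠ 0` is maximal, hence contains F(s). So
    -- a power of F(s) would be a multiple of `u`.
    have hrad : (⟨aeval s F, hFB⟩ : B) ∈ (Ideal.span {(⟨u, huB⟩ : B)}).radical := by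
      rw [Ideal.radical_eq_sInf, Ideal.mem_sInf]
      rintro J ⟨hJ, hJp⟩
      have hJ0 : J ≠ ⊥ := by
        rintro rfl
        have : (⟨u, huB⟩ : B) = 0 := by
          simpa using hJ
        exact hu0 (congrArg Subtype.val this)
      have := hJp.isMaximal_of_ne_bot hJ0
      rw [IsLocalRing.eq_maximalIdeal this]
      exact (hdom.mem_maximalIdeal _).2 hF1
    obtain ⟨k, hk⟩ := hrad
    obtain ⟨⟨z, hz⟩, hzk⟩ := Ideal.mem_span_singleton.1 hk
    obtain ⟨f, hf, g, hg, hg1, rfl⟩ := hz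
    have hg0 : g ≠ 0 := fun h => by simp [h] at hg1
    obtain ⟨H, rfl⟩ := mem_closure_iff.1 hf
    obtain ⟨G, rfl⟩ := mem_closure_iff.1 hg
    have hz2 : aeval s F ^ k = u * (aeval s H / aeval s G) := congrArg Subtype.val hzk
    have hzero : aeval s (F ^ k * G - C (⟨u, h.mem_left⟩ : A) * H) = 0 := by
      rw [map_sub, map_mul, map_mul, map_pow, hz2, aeval_C]
      change u * (aeval s H / aeval s G) * aeval s G - u * aeval s H = 0
      field_simp
      ring
    -- Modulo the maximal ideal of `A` the relation F^k G = uH becomes F^k G = 0. As `F` is monic,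
    -- `G` reduces to zero, and the denominator G(s) would not have value one.
    have hco := h.coeff_lt_one_of_aeval_eq_zero hA _ hzero
    have hAloc := hA.isLocalRing
    have hmap0 : (F ^ k * G - C (⟨u, h.mem_left⟩ : A) * H).map (IsLocalRing.residue A) = 0 := by
      refine Polynomial.ext fun i => ?_
      rw [coeff_map, coeff_zero, IsLocalRing.residue_eq_zero_iff, hA.mem_maximalIdeal]
      exact hco i
    have hu' : IsLocalRing.residue A ⟨u, h.mem_left⟩ = 0 := by
      rw [IsLocalRing.residue_eq_zero_iff, hA.mem_maximalIdeal]
      exact h.lt_one hA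
    rw [Polynomial.map_sub, Polynomial.map_mul, Polynomial.map_mul, map_C, hu', C_0, zero_mul,
      sub_zero, Polynomial.map_pow] at hmap0
    have hG0 : G.map (IsLocalRing.residue A) = 0 :=
      (mul_eq_zero.1 hmap0).resolve_left (pow_ne_zero _ (hF.map _).ne_zero)
    obtain ⟨r, hr, hre⟩ := h.exists_eq_mul_of_coeff_lt_one hA G fun i => by
      rw [← hA.mem_maximalIdeal, ← IsLocalRing.residue_eq_zero_iff, ← coeff_map, hG0, coeff_zero]
    have hlt1 : ν (aeval s G) < 1 := by
      rw [hre, map_mul]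
      exact mul_lt_one_of_lt_of_le (h.lt_one hA) (hdom.le_one (hCB hr))
    exact hlt1.ne hg1
  have hrank : (IsLocalRing.maximalIdeal B).spanFinrank ≤ 2 := by
    rw [← hspan]
    refine (Submodule.spanFinrank_span_le_ncard_of_finite (Set.toFinite _)).trans ?_
    exact (Set.ncard_insert_le _ _).trans (by rw [Set.ncard_singleton])
  have hrank' : ((IsLocalRing.maximalIdeal B).spanFinrank : WithBot ℕ∞) ≤ 2 := by
    exact_mod_cast hrank
  exact ⟨IsRegularLocalRing.of_spanFinrank_maximalIdeal_le _ (hrank'.trans hdim2), huB, hFB,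
    le_antisymm ((ringKrullDim_le_spanFinrank_maximalIdeal B).trans hrank') hdim2, hspan⟩

end GenSeq

namespace GenSeq

variable {K : Type*} [Field K] {Γ₀ : Type*} [LinearOrderedCommGroupWithZero Γ₀]
  {ν : Valuation K Γ₀} {A : Subring K}

/-! ### Chains of quadratic transforms -/

theorem baseField_mono {A B : Subring K} (h : A ≤ B) : baseField ν A ≤ baseField ν B :=
  Subfield.closure_mono (Set.image_mono h)

theorem baseField_blowUp (hA : Dominates ν A) {s : K} (hs : ν s ≤ 1) :
    baseField ν (blowUp ν A s) = baseField ν A ⊔ Subfield.closure {resid ν s} := by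
  have hdom := dominates_blowUp hA hs
  apply le_antisymm
  · have hpoly : ∀ f ∈ Subring.closure ((A : Set K) ∪ {s}),
        resid ν f ∈ baseField ν A ⊔ Subfield.closure {resid ν s} := by
      intro f hf
      obtain ⟨G, rfl⟩ := mem_closure_iff.1 hf
      have hcs : ∀ i, G.coeff i • s ^ i = (G.coeff i : K) * s ^ i := fun i => rfl
      have hc : ∀ i, ν (G.coeff i : K) ≤ 1 := fun i => (hA _).1
      have hp : ∀ i, ν (s ^ i) ≤ 1 := fun i => by rw [map_pow]; exact pow_le_one' hs i
      rw [Polynomial.aeval_eq_sum_range, resid_sum _ _ fun i _ => by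
        rw [hcs, map_mul]; exact mul_le_one' (hc i) (hp i)]
      refine sum_mem fun i _ => ?_
      rw [hcs, resid_mul (hc i) (hp i), resid_pow hs]
      refine mul_mem ?_ (pow_mem ?_ _)
      · exact (le_sup_left : baseField ν A ≤ _) (resid_mem_baseField ν (G.coeff i).2)
      · exact (le_sup_right : Subfield.closure {resid ν s} ≤ baseField ν A ⊔ _)
          (Subfield.subset_closure rfl)
    rw [baseField, Subfield.closure_le]
    rintro _ ⟨_, ⟨f, hf, g, hg, hg1, rfl⟩, rfl⟩
    rw [div_eq_mul_inv, resid_mul (le_one_of_mem_closure hA hs hf)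
      (by rw [map_inv₀, hg1, inv_one]), resid_inv hg1]
    exact mul_mem (hpoly f hf) (inv_mem (hpoly g hg))
  · refine sup_le (baseField_mono (le_blowUp A s)) ?_
    rw [Subfield.closure_le, Set.singleton_subset_iff]
    exact resid_mem_baseField ν (mem_blowUp A s)

theorem baseField_blowUp_of_lt (hA : Dominates ν A) {s : K} (hs : ν s < 1) :
    baseField ν (blowUp ν A s) = baseField ν A := by
  rw [baseField_blowUp hA hs.le, (resid_eq_zero_iff hs.le).2 hs, sup_eq_left,
    Subfield.closure_le, Set.singleton_subset_iff]
  exact zero_mem _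

open Polynomial in
-- The class of `v / u` is zero, so its minimal polynomial lifts to `X`.
theorem IsRegularParameters.blowUp_of_lt {u v : K} (h : IsRegularParameters A u v)
    (hA : Dominates ν A) (hlt : ν v < ν u) :
    IsRegularParameters (GenSeq.blowUp ν A (v / u)) u (v / u) := by
  have hν0 : 0 < ν u := (Valuation.pos_iff ν).2 h.left_ne_zero
  have := h.blowUp hA hlt.le X monic_X (by
    rw [aeval_X, map_div₀]; exact (div_lt_one₀ hν0).2 hlt) (by
    intro G hG hG1 i
    rw [natDegree_X, Nat.lt_one_iff] at hG
    rw [eq_C_of_natDegree_eq_zero hG] at hG1 ⊢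
    rw [aeval_C] at hG1
    rw [coeff_C]
    split_ifs
    · exact hG1
    · simp)
  rwa [aeval_X] at this

/-- Euclid's algorithm: one transform replaces (u, v) by (u/v, v) or (u, v/u) and (p, q) by (p, q -
p) or (p - q, q), and preserves v^q/u^p. The conditions `0 < a + c` and `0 < b + d` say that both
parameters divide `u * v` in every intermediate ring. -/
theorem exists_quadraticSeq_isRegularParameters (p q : ℕ) (hp : 0 < p) (hq : 0 < q)
    (hpq : p.Coprime q) {A : Subring K} {u v : K} (hA : Dominates ν A)
    (h : IsRegularParameters A u v) (hval : ν v ^ q = ν u ^ p) :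
    ∃ (i : ℕ) (x₁ : K) (k l : ℤ),
      u = x₁ ^ q * (v ^ q / u ^ p) ^ k ∧ v = x₁ ^ p * (v ^ q / u ^ p) ^ l ∧
      IsRegularParameters (quadraticSeq ν A i) x₁ (x₁ * (v ^ q / u ^ p)) ∧
      Dominates ν (quadraticSeq ν A i) ∧ A ≤ quadraticSeq ν A i ∧
      baseField ν (quadraticSeq ν A i) = baseField ν A ∧
      ∀ j ≤ i, ∃ (u' v' : K) (a b c d : ℕ), IsRegularParameters (quadraticSeq ν A j) u' v' ∧
        u = u' ^ a * v' ^ b ∧ v = u' ^ c * v' ^ d ∧ 0 < a + c ∧ 0 < b + d := by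
  obtain ⟨N, hN⟩ : ∃ N, p + q ≤ N := ⟨_, le_rfl⟩
  induction N generalizing p q A u v with
  | zero => omega
  | succ N ih =>
    have hu0 := h.left_ne_zero
    have hv0 := h.symm.left_ne_zero
    have hνu0 : 0 < ν u := (Valuation.pos_iff ν).2 hu0
    have hνv0 : 0 < ν v := (Valuation.pos_iff ν).2 hv0
    rcases lt_trichotomy p q with hlt | heq | hlt
    · obtain ⟨r, rfl⟩ := Nat.exists_eq_add_of_lt hlt
      have hltν : ν u < ν v := by
        refine lt_of_pow_lt_pow_left₀ p zero_le ?_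
        rw [← hval]
        exact pow_lt_pow_right_of_lt_one₀ hνv0 (h.symm.lt_one hA) hlt
      have hT := quadraticTransform_eq hA h.symm hltν.le
      have hreg := (h.symm.blowUp_of_lt hA hltν).symm
      have hs1 : ν (u / v) < 1 := by rw [map_div₀]; exact (div_lt_one₀ hνv0).2 hltν
      have hdom := dominates_blowUp hA hs1.le
      rw [← hT] at hreg hdom
      obtain ⟨i, x₁, k, l, h1, h2, h3, h4, h5, h6, h7⟩ := ih p (r + 1) hp (by omega)
        (by rw [add_assoc] at hpq; exact Nat.coprime_self_add_right.1 hpq)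
        hdom hreg (by
          rw [map_div₀, div_pow, ← hval, eq_div_iff (pow_pos hνv0 _).ne', ← pow_add]
          congr 1; omega) (by omega)
      have hs : v ^ (r + 1) / (u / v) ^ p = v ^ (p + r + 1) / u ^ p := by
        rw [add_assoc, pow_add v p, div_pow]; field_simp
      rw [hs] at h1 h2 h3
      rw [← quadraticSeq_succ'] at h3 h4 h5 h6
      have hs0 : v ^ (p + r + 1) / u ^ p ≠ 0 := by positivity
      refine ⟨i + 1, x₁, k + l, l, ?_, h2, h3, h4, ?_, ?_, ?_⟩
      · rw [zpow_add₀ hs0, add_assoc, pow_add]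
        calc u = (u / v) * v := by field_simp
          _ = (x₁ ^ (r + 1) * (v ^ (p + r + 1) / u ^ p) ^ k) *
              (x₁ ^ p * (v ^ (p + r + 1) / u ^ p) ^ l) := by rw [← h1, ← h2]
          _ = _ := by rw [add_assoc]; ring
      · exact (le_blowUp A _).trans (hT ▸ h5)
      · rw [h6, hT, baseField_blowUp_of_lt hA hs1]
      · rintro (_ | j) hj
        · exact ⟨u, v, 1, 0, 0, 1, h, by simp, by simp, by simp, by simp⟩
        · obtain ⟨u', v', a, b, c, d, g1, g2, g3, g4, g5⟩ := h7 j (by omega)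
          rw [← quadraticSeq_succ'] at g1
          refine ⟨u', v', a + c, b + d, c, d, g1, ?_, g3, by omega, by omega⟩
          calc u = (u / v) * v := by field_simp
            _ = (u' ^ a * v' ^ b) * (u' ^ c * v' ^ d) := by rw [← g2, ← g3]
            _ = _ := by ring
    · subst heq
      -- Coprimality makes p = q = 1 the only stopping point, and there `x₁ = u`.
      obtain rfl : p = 1 := (Nat.coprime_self p).1 hpq
      refine ⟨0, u, 0, 1, by simp, ?_, ?_, hA, le_rfl, rfl, ?_⟩
      · simp only [pow_one, zpow_one]; field_simp
      · have : u * (v ^ 1 / u ^ 1) = v := by field_simp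
        rw [this]; exact h
      · intro j hj
        obtain rfl : j = 0 := by omega
        exact ⟨u, v, 1, 0, 0, 1, h, by simp, by simp, by simp, by simp⟩
    · obtain ⟨r, rfl⟩ := Nat.exists_eq_add_of_lt hlt
      have hltν : ν v < ν u := by
        refine lt_of_pow_lt_pow_left₀ q zero_le ?_
        rw [hval]
        exact pow_lt_pow_right_of_lt_one₀ hνu0 (h.lt_one hA) hlt
      have hT := quadraticTransform_eq hA h hltν.le
      have hreg := h.blowUp_of_lt hA hltν
      have hs1 : ν (v / u) < 1 := by rw [map_div₀]; exact (div_lt_one₀ hνu0).2 hltν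
      have hdom := dominates_blowUp hA hs1.le
      rw [← hT] at hreg hdom
      obtain ⟨i, x₁, k, l, h1, h2, h3, h4, h5, h6, h7⟩ := ih (r + 1) q (by omega) hq
        (by rw [add_assoc] at hpq; exact Nat.coprime_self_add_left.1 hpq)
        hdom hreg (by
          rw [map_div₀, div_pow, hval, div_eq_iff (pow_pos hνu0 _).ne', ← pow_add]
          congr 1; omega) (by omega)
      have hs : (v / u) ^ q / u ^ (r + 1) = v ^ q / u ^ (q + r + 1) := by
        rw [add_assoc, pow_add u q, div_pow]; field_simp
      rw [hs] at h1 h2 h3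
      rw [← quadraticSeq_succ'] at h3 h4 h5 h6
      have hs0 : v ^ q / u ^ (q + r + 1) ≠ 0 := by positivity
      refine ⟨i + 1, x₁, k, k + l, h1, ?_, h3, h4, ?_, ?_, ?_⟩
      · rw [zpow_add₀ hs0]
        calc v = u * (v / u) := by field_simp
          _ = (x₁ ^ q * (v ^ q / u ^ (q + r + 1)) ^ k) *
              (x₁ ^ (r + 1) * (v ^ q / u ^ (q + r + 1)) ^ l) := by rw [← h1, ← h2]
          _ = _ := by rw [add_assoc q r 1, pow_add x₁ q]; ring
      · exact (le_blowUp A _).trans (hT ▸ h5)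
      · rw [h6, hT, baseField_blowUp_of_lt hA hs1]
      · rintro (_ | j) hj
        · exact ⟨u, v, 1, 0, 0, 1, h, by simp, by simp, by simp, by simp⟩
        · obtain ⟨u', v', a, b, c, d, g1, g2, g3, g4, g5⟩ := h7 j (by omega)
          rw [← quadraticSeq_succ'] at g1
          refine ⟨u', v', a, b, a + c, b + d, g1, g2, ?_, by omega, by omega⟩
          calc v = u * (v / u) := by field_simp
            _ = (u' ^ a * v' ^ b) * (u' ^ c * v' ^ d) := by rw [← g2, ← g3]
            _ = _ := by ring

/-! ### Divisors with one or two components -/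

theorem not_divisorHasOneComponent {u v : K} (h : IsRegularParameters A u v) {a b : ℕ}
    (ha : 0 < a) (hb : 0 < b) : ¬ DivisorHasOneComponent A (u ^ a * v ^ b) := by
  rintro ⟨hf, p, hp, huniq⟩
  let u' : A := ⟨u, h.mem_left⟩
  let v' : A := ⟨v, h.mem_right⟩
  have hfe : (⟨u ^ a * v ^ b, hf⟩ : A) = u' ^ a * v' ^ b := rfl
  obtain ⟨hu, hvu⟩ := h.isPrime_span
  obtain ⟨hv, huv⟩ := h.symm.isPrime_span
  have hmin : ∀ J : Ideal A, J.IsPrime → Ideal.span {(⟨u ^ a * v ^ b, hf⟩ : A)} ≤ J →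
      Ideal.span {u'} ≤ J ∨ Ideal.span {v'} ≤ J := by
    intro J hJ hle
    rw [Ideal.span_singleton_le_iff_mem, hfe] at hle
    rcases hJ.mem_or_mem hle with h1 | h1
    · exact Or.inl ((Ideal.span_singleton_le_iff_mem _).2 (hJ.mem_of_pow_mem _ h1))
    · exact Or.inr ((Ideal.span_singleton_le_iff_mem _).2 (hJ.mem_of_pow_mem _ h1))
  have hmu : Ideal.span {u'} ∈ (Ideal.span {(⟨u ^ a * v ^ b, hf⟩ : A)}).minimalPrimes := by
    refine ⟨⟨hu, ?_⟩, ?_⟩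
    · rw [Ideal.span_singleton_le_iff_mem, hfe]
      exact Ideal.mul_mem_right _ _
        (Ideal.pow_mem_of_mem _ (Ideal.mem_span_singleton_self u') a ha)
    · rintro J ⟨hJ, hle⟩ hJu
      rcases hmin J hJ hle with h1 | h1
      · exact h1
      · exact absurd (hJu (h1 (Ideal.mem_span_singleton_self v'))) hvu
  have hmv : Ideal.span {v'} ∈ (Ideal.span {(⟨u ^ a * v ^ b, hf⟩ : A)}).minimalPrimes := by
    refine ⟨⟨hv, ?_⟩, ?_⟩
    · rw [Ideal.span_singleton_le_iff_mem, hfe]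
      exact Ideal.mul_mem_left _ _
        (Ideal.pow_mem_of_mem _ (Ideal.mem_span_singleton_self v') b hb)
    · rintro J ⟨hJ, hle⟩ hJv
      rcases hmin J hJ hle with h1 | h1
      · exact absurd (hJv (h1 (Ideal.mem_span_singleton_self u'))) huv
      · exact h1
  have heq : Ideal.span {u'} = Ideal.span {v'} := (huniq _ hmu).trans (huniq _ hmv).symm
  exact hvu (by
    change v' ∈ Ideal.span {u'}
    rw [heq]; exact Ideal.mem_span_singleton_self v')

theorem divisorHasOneComponent {u z : K} (hu : u ∈ A) (hp : (Ideal.span {(⟨u, hu⟩ : A)}).IsPrime)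
    {N : ℕ} (hN : 0 < N) (hz : z ∈ A) (hz' : z⁻¹ ∈ A) (hz0 : z ≠ 0) :
    DivisorHasOneComponent A (u ^ N * z) := by
  let u' : A := ⟨u, hu⟩
  let z' : A := ⟨z, hz⟩
  refine ⟨A.mul_mem (A.pow_mem hu N) hz, Ideal.span {u'}, ⟨⟨hp, ?_⟩, ?_⟩, ?_⟩
  · rw [Ideal.span_singleton_le_iff_mem]
    exact Ideal.mul_mem_right z' _ (Ideal.pow_mem_of_mem _ (Ideal.mem_span_singleton_self u') N hN)
  all_goals
    have key : ∀ J : Ideal A, J.IsPrime →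
        Ideal.span {(⟨u ^ N * z, A.mul_mem (A.pow_mem hu N) hz⟩ : A)} ≤ J →
        Ideal.span {u'} ≤ J := by
      intro J hJ hle
      rw [Ideal.span_singleton_le_iff_mem] at hle ⊢
      refine hJ.mem_of_pow_mem N ?_
      convert J.mul_mem_left (⟨z⁻¹, hz'⟩ : A) hle using 1
      apply Subtype.ext
      change u ^ N = z⁻¹ * (u ^ N * z)
      field_simp
  · rintro J ⟨hJ, hle⟩ -
    exact key J hJ hle
  · rintro J ⟨⟨hJ, hle⟩, hJmin⟩
    refine le_antisymm (hJmin ⟨hp, ?_⟩ (key J hJ hle)) (key J hJ hle)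
    rw [Ideal.span_singleton_le_iff_mem]
    exact Ideal.mul_mem_right z' _ (Ideal.pow_mem_of_mem _ (Ideal.mem_span_singleton_self u') N hN)

end GenSeq

namespace GenSeq

/-! ### Indices of cyclic extensions -/

/-- The quotient is cyclic, generated by the class of `b`, whose `m`-th power is trivial. -/
theorem _root_.Subgroup.relIndex_zpowers_sup_dvd {G : Type*} [CommGroup G] (a b : G) {m : ℕ}
    (h : b ^ m ∈ Subgroup.zpowers a) :
    (Subgroup.zpowers a).relIndex (Subgroup.zpowers a ⊔ Subgroup.zpowers b) ∣ m := by
  rw [Subgroup.relIndex_sup_left, Subgroup.relIndex, Subgroup.index]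
  let b' : Subgroup.zpowers b := ⟨b, Subgroup.mem_zpowers b⟩
  let c : Subgroup.zpowers b ⧸ (Subgroup.zpowers a).subgroupOf (Subgroup.zpowers b) :=
    QuotientGroup.mk b'
  have hgen : ∀ z, z ∈ Subgroup.zpowers c := by
    intro z
    obtain ⟨⟨z, i, rfl⟩, rfl⟩ := QuotientGroup.mk_surjective z
    exact ⟨i, rfl⟩
  rw [← orderOf_eq_card_of_forall_mem_zpowers hgen, orderOf_dvd_iff_pow_eq_one]
  change QuotientGroup.mk (b' ^ m) = _
  rw [QuotientGroup.eq_one_iff, Subgroup.mem_subgroupOf]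
  exact h

variable {K : Type*} [Field K] {Γ₀ : Type*} [LinearOrderedCommGroupWithZero Γ₀]
  {ν : Valuation K Γ₀} {P : ℕ → K}

theorem valueGroup_zero {a : Γ₀ˣ} (ha : (a : Γ₀) = ν (P 0)) :
    valueGroup ν P 0 = Subgroup.zpowers a := by
  rw [valueGroup, Subgroup.zpowers_eq_closure]
  congr 1
  ext g
  simp only [nonpos_iff_eq_zero, exists_eq_left, Set.mem_ofPred_eq, Set.mem_singleton_iff, ← ha,
    Units.val_inj]

theorem valueGroup_succ {i : ℕ} {a : Γ₀ˣ} (ha : (a : Γ₀) = ν (P (i + 1))) :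
    valueGroup ν P (i + 1) = valueGroup ν P i ⊔ Subgroup.zpowers a := by
  rw [valueGroup, valueGroup, Subgroup.zpowers_eq_closure, ← Subgroup.closure_union]
  congr 1
  ext g
  simp only [Set.mem_ofPred_eq, Set.mem_union, Set.mem_singleton_iff]
  constructor
  · rintro ⟨j, hj, hg⟩
    rcases Nat.lt_or_ge i j with h | h
    · obtain rfl : j = i + 1 := by omega
      exact Or.inr (Units.ext (hg.trans ha.symm))
    · exact Or.inl ⟨j, h, hg⟩
  · rintro (⟨j, hj, hg⟩ | rfl)
    · exact ⟨j, by omega, hg⟩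
    · exact ⟨i + 1, le_rfl, ha⟩

/-- Let g = gcd(p, q). An ordered group has no torsion, so g can be cancelled in the relation; then
the (q/g)-th power of ν(P 1) lies in the group of ν(P 0), and the index q divides q/g. -/
theorem coprime_of_pow_nbar_eq (h0 : P 0 ≠ 0) (h1 : P 1 ≠ 0) {p : ℕ} (hn : nbar ν P 1 ≠ 0)
    (h : ν (P 1) ^ nbar ν P 1 = ν (P 0) ^ p) : p.Coprime (nbar ν P 1) := by
  let a : Γ₀ˣ := Units.mk0 (ν (P 0)) ((Valuation.ne_zero_iff ν).2 h0)
  let b : Γ₀ˣ := Units.mk0 (ν (P 1)) ((Valuation.ne_zero_iff ν).2 h1)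
  have hidx : nbar ν P 1 =
      (Subgroup.zpowers a).relIndex (Subgroup.zpowers a ⊔ Subgroup.zpowers b) := by
    rw [nbar, valueGroup_succ (i := 0) (a := b) rfl, Nat.sub_self, valueGroup_zero (a := a) rfl]
  set q := nbar ν P 1
  set g := p.gcd q with hg
  have hg0 : 0 < g := Nat.gcd_pos_of_pos_right p (Nat.pos_of_ne_zero hn)
  obtain ⟨p', hp'⟩ : g ∣ p := Nat.gcd_dvd_left p q
  obtain ⟨q', hq'⟩ : g ∣ q := Nat.gcd_dvd_right p q
  have hpow : (ν (P 1) ^ q') ^ g = (ν (P 0) ^ p') ^ g := by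
    rw [← pow_mul, ← pow_mul, mul_comm q', mul_comm p', ← hq', ← hp', h]
  have heq := (pow_left_inj₀ zero_le zero_le hg0.ne').1 hpow
  have hmem : b ^ q' ∈ Subgroup.zpowers a :=
    ⟨p', by
      apply Units.ext
      simpa [a, b] using heq.symm⟩
  have hdvd := Subgroup.relIndex_zpowers_sup_dvd a b hmem
  rw [← hidx, hq'] at hdvd
  have hq'0 : 0 < q' := Nat.pos_of_ne_zero (by rintro rfl; simp [hq'] at hn)
  have : g * q' ≤ 1 * q' := by simpa using Nat.le_of_dvd hq'0 hdvd
  exact le_antisymm (Nat.le_of_mul_le_mul_right this hq'0) hg0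

/-! ### The tower of residue fields -/

variable {A : Subring K} {w : ℕ → ℕ → ℕ}

theorem towerField_zero : towerField ν A P w 0 = baseField ν A := by
  rw [towerField, sup_eq_left]
  have : {a | ∃ j, 1 ≤ j ∧ j ≤ 0 ∧ a = alpha ν P w j} = ∅ := by
    ext a
    simp only [Set.mem_ofPred_eq, Set.mem_empty_iff_false, iff_false]
    rintro ⟨j, h1, h2, -⟩
    omega
  rw [this, Subfield.closure_empty]
  exact bot_le

theorem towerField_succ (i : ℕ) : towerField ν A P w (i + 1) =
    towerField ν A P w i ⊔ Subfield.closure {alpha ν P w (i + 1)} := by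
  rw [towerField, towerField, sup_assoc, ← Subfield.closure_union]
  congr 2
  ext a
  simp only [Set.mem_ofPred_eq, Set.mem_union, Set.mem_singleton_iff]
  constructor
  · rintro ⟨j, h1, h2, rfl⟩
    rcases Nat.lt_or_ge i j with h | h
    · obtain rfl : j = i + 1 := by omega
      exact Or.inr rfl
    · exact Or.inl ⟨j, h1, h, rfl⟩
  · rintro (⟨j, h1, h2, rfl⟩ | rfl)
    · exact ⟨j, h1, by omega, rfl⟩
    · exact ⟨i + 1, by omega, le_rfl, rfl⟩

theorem towerField_mono {i j : ℕ} (h : i ≤ j) : towerField ν A P w i ≤ towerField ν A P w j := by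
  induction h with
  | refl => exact le_rfl
  | step _ ih => exact ih.trans (by rw [Nat.succ_eq_add_one, towerField_succ]; exact le_sup_left)

theorem alpha_mem_towerField {i j : ℕ} (hj : 1 ≤ j) (hji : j ≤ i) :
    alpha ν P w j ∈ towerField ν A P w i :=
  (le_sup_right : Subfield.closure _ ≤ towerField ν A P w i)
    (Subfield.subset_closure (show alpha ν P w j ∈ {a | ∃ j, 1 ≤ j ∧ j ≤ i ∧ a = alpha ν P w j} from
      ⟨j, hj, hji, rfl⟩))

namespace Dominates

/-- The residue map into a subfield of `L` that contains the residue field. -/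
noncomputable def resHomTo (hA : Dominates ν A) (E : Subfield (ResField ν))
    (hE : baseField ν A ≤ E) : A →+* E :=
  hA.resHom.codRestrict E fun a => hE (resid_mem_baseField ν a.2)

@[simp] theorem coe_resHomTo (hA : Dominates ν A) (E : Subfield (ResField ν))
    (hE : baseField ν A ≤ E) (a : A) : ((hA.resHomTo E hE a : E) : ResField ν) = resid ν (a : K) :=
  rfl

theorem exists_residueField_equiv (hA : Dominates ν A) {E : Subfield (ResField ν)}
    (hE : baseField ν A = E) :
    ∃ (_ : IsLocalRing A) (φ : IsLocalRing.ResidueField A ≃+* E),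
      ∀ f : A, ((φ (IsLocalRing.residue A f) : E) : ResField ν) = resid ν (f : K) := by
  have hloc := hA.isLocalRing
  let ψ := hA.resHomTo E hE.le
  have hψ : IsLocalHom ψ := by
    refine ⟨fun a ha => ?_⟩
    rw [hA.isUnit_iff]
    by_contra hne
    have : ψ a = 0 := Subtype.ext
      ((resid_eq_zero_iff (hA a).1).2 (lt_of_le_of_ne (hA a).1 hne))
    rw [this] at ha
    exact not_isUnit_zero ha
  refine ⟨hloc, RingEquiv.ofBijective (IsLocalRing.ResidueField.lift ψ)
    ⟨RingHom.injective _, ?_⟩, fun f => rfl⟩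
  rintro ⟨z, hz⟩
  rw [← hE, hA.mem_baseField] at hz
  obtain ⟨f, hf, rfl⟩ := hz
  exact ⟨IsLocalRing.residue A ⟨f, hf⟩, rfl⟩

open Polynomial in
theorem aeval_map_resHomTo (hA : Dominates ν A) {E : Subfield (ResField ν)}
    (hE : baseField ν A ≤ E) {s : K} (hs : ν s ≤ 1) (G : Polynomial A) :
    aeval (resid ν s) (G.map (hA.resHomTo E hE)) = resid ν (aeval s G) := by
  have hcs : ∀ i, G.coeff i • s ^ i = (G.coeff i : K) * s ^ i := fun i => rfl
  have hc : ∀ i, ν (G.coeff i : K) ≤ 1 := fun i => (hA _).1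
  have hp : ∀ i, ν (s ^ i) ≤ 1 := fun i => by rw [map_pow]; exact pow_le_one' hs i
  rw [aeval_eq_sum_range (p := G), resid_sum _ _ fun i _ => by
    rw [hcs, map_mul]; exact mul_le_one' (hc i) (hp i)]
  rw [aeval_def, eval₂_map, eval₂_eq_sum_range]
  refine Finset.sum_congr rfl fun i _ => ?_
  rw [hcs, resid_mul (hc i) (hp i), resid_pow hs]
  rfl

open Polynomial in
/-- A polynomial of smaller degree than the minimal polynomial of the residue class of `s` over an
extension of the residue field is residually zero as soon as its value at `s` is. -/
theorem coeff_lt_one_of_natDegree_lt (hA : Dominates ν A) {E : Subfield (ResField ν)}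
    (hE : baseField ν A ≤ E) {s : K} (hs : ν s ≤ 1) (G : Polynomial A)
    (hG : G.natDegree < (minpoly E (resid ν s)).natDegree) (hG1 : ν (aeval s G) < 1) (i : ℕ) :
    ν (G.coeff i : K) < 1 := by
  have hev : aeval (resid ν s) (G.map (hA.resHomTo E hE)) = 0 := by
    rw [aeval_map_resHomTo hA hE hs G, resid_eq_zero_iff hG1.le]
    exact hG1
  have hzero : G.map (hA.resHomTo E hE) = 0 := by
    by_contra hne
    have := minpoly.degree_le_of_ne_zero E _ hne hev
    have h2 := natDegree_le_natDegree this
    exact absurd (h2.trans natDegree_map_le) (not_le.2 hG)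
  have hc := congrArg (fun H => ((H.coeff i : E) : ResField ν)) hzero
  simp only [coeff_map, coe_resHomTo, coeff_zero, ZeroMemClass.coe_zero] at hc
  exact (resid_eq_zero_iff (hA _).1).1 hc

end Dominates

namespace IsRegularParameters

theorem mul_right {u v z : K} (h : IsRegularParameters A u v) (hz : z ∈ A) (hz' : z⁻¹ ∈ A)
    (hz0 : z ≠ 0) : IsRegularParameters A u (v * z) := by
  obtain ⟨h1, hu, hv, h2, h3⟩ := h
  refine ⟨h1, hu, A.mul_mem hv hz, h2, ?_⟩
  rw [← h3]
  have e1 : (⟨v * z, A.mul_mem hv hz⟩ : A) = ⟨z, hz⟩ * ⟨v, hv⟩ := Subtype.ext (mul_comm _ _)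
  have e2 : (⟨v, hv⟩ : A) = ⟨z⁻¹, hz'⟩ * ⟨v * z, A.mul_mem hv hz⟩ := by
    apply Subtype.ext
    change v = z⁻¹ * (v * z)
    field_simp
  apply le_antisymm
  · rw [Ideal.span_le]
    rintro t (rfl | rfl)
    · exact Ideal.subset_span (by simp)
    · rw [e1]; exact Ideal.mul_mem_left _ _ (Ideal.subset_span (by simp))
  · rw [Ideal.span_le]
    rintro t (rfl | rfl)
    · exact Ideal.subset_span (by simp)
    · rw [SetLike.mem_coe, e2]
      exact Ideal.mul_mem_left _ _ (Ideal.subset_span (by simp))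

end IsRegularParameters

/-- As `s` is a unit of `B`, a power of `z` is a multiple of `x`, so `z` lies in the radical.
Conversely `x` and `y` are multiples of `z`, and (z) is prime. -/
theorem isExceptionalEquation {A B : Subring K} (hA : Dominates ν A) (hAB : A ≤ B) {x y z s t : K}
    {a b : ℕ} (h : IsRegularParameters A x y) (hz : z ∈ B)
    (hp : (Ideal.span {(⟨z, hz⟩ : B)}).IsPrime) (ha : 0 < a) (hb : 0 < b) (hs : s ∈ B)
    (hs' : s⁻¹ ∈ B) (hs0 : s ≠ 0) (ht : t ∈ B) (hx : x = z ^ a * s) (hy : y = z ^ b * t) :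
    IsExceptionalEquation A B z := by
  have hloc := hA.isLocalRing
  refine ⟨hloc, hAB, hz, le_antisymm ?_ ?_⟩
  · rw [Ideal.span_singleton_le_iff_mem]
    refine ⟨a, ?_⟩
    have hmem : Subring.inclusion hAB ⟨x, h.mem_left⟩ ∈
        (IsLocalRing.maximalIdeal A).map (Subring.inclusion hAB) :=
      Ideal.mem_map_of_mem _ ((hA.mem_maximalIdeal _).2 (h.lt_one hA))
    convert Ideal.mul_mem_left _ (⟨s⁻¹, hs'⟩ : B) hmem using 1
    apply Subtype.ext
    change z ^ a = s⁻¹ * x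
    rw [hx]; field_simp
  · rw [hp.radical_le_iff, Ideal.map_le_iff_le_comap]
    rintro ⟨f, hf⟩ hfm
    rw [hA.mem_maximalIdeal] at hfm
    obtain ⟨c, hc, d, hd, rfl⟩ := h.exists_eq hA hf hfm
    obtain ⟨a, rfl⟩ := Nat.exists_eq_succ_of_ne_zero ha.ne'
    obtain ⟨b, rfl⟩ := Nat.exists_eq_succ_of_ne_zero hb.ne'
    rw [Ideal.mem_comap, Ideal.mem_span_singleton]
    refine ⟨⟨c * (z ^ a * s) + d * (z ^ b * t), B.add_mem
      (B.mul_mem (hAB hc) (B.mul_mem (B.pow_mem hz _) hs))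
      (B.mul_mem (hAB hd) (B.mul_mem (B.pow_mem hz _) ht))⟩, Subtype.ext ?_⟩
    change c * x + d * y = z * (c * (z ^ a * s) + d * (z ^ b * t))
    rw [hx, hy, Nat.succ_eq_add_one, Nat.succ_eq_add_one]; ring

end GenSeq

/-! ### Scaled minimal polynomials and orders along the exceptional divisor -/

namespace GenSeq

open Polynomial in
theorem coeff_X_pow_add_sum {F : Type*} [Field F] (d : ℕ) (c : ℕ → F) (i : ℕ) :
    (X ^ d + ∑ t ∈ Finset.range d, C (c t) * X ^ t).coeff i =
      if i = d then 1 else if i < d then c i else 0 := by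
  rw [coeff_add, coeff_X_pow, finsetSum_coeff]
  simp only [coeff_C_mul_X_pow]
  rw [Finset.sum_ite_eq]
  simp only [Finset.mem_range]
  split_ifs <;> first | omega | simp

open Polynomial in
theorem natDegree_X_pow_add_sum {F : Type*} [Field F] (d : ℕ) (c : ℕ → F) :
    (X ^ d + ∑ t ∈ Finset.range d, C (c t) * X ^ t).natDegree = d := by
  apply le_antisymm
  · rw [natDegree_le_iff_coeff_eq_zero]
    intro i hi
    rw [coeff_X_pow_add_sum, if_neg (by omega), if_neg (by omega)]
  · apply le_natDegree_of_ne_zero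
    rw [coeff_X_pow_add_sum, if_pos rfl]
    exact one_ne_zero

open Polynomial in
theorem minpoly_mul_eq {F L : Type*} [Field F] [Field L] [Algebra F L] {a : L} {γ : F}
    (hγ : γ ≠ 0) {d : ℕ} (hd : 1 ≤ d) {b : ℕ → F}
    (h : minpoly F a = X ^ d + ∑ t ∈ Finset.range d, C (b t) * X ^ t) :
    minpoly F (a * algebraMap F L γ) =
      X ^ d + ∑ t ∈ Finset.range d, C (b t * γ ^ (d - t)) * X ^ t := by
  have hdeg : (minpoly F a).natDegree = d := by rw [h, natDegree_X_pow_add_sum]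
  -- `minpoly` is zero at a transcendental element, which the degree d ≥ 1 excludes.
  have hint : IsIntegral F a := by
    by_contra hni
    rw [minpoly.eq_zero hni, natDegree_zero] at hdeg
    omega
  have hsm : a * algebraMap F L γ = γ • a := by rw [Algebra.smul_def, mul_comm]
  rw [hsm, IsIntegrallyClosed.minpoly_smul hγ hint]
  ext i
  rw [coeff_scaleRoots, hdeg, h, coeff_X_pow_add_sum, coeff_X_pow_add_sum]
  split_ifs with h1 h2
  · subst h1; simp
  · rfl
  · simp

/-- Comparison of digits in a mixed radix. Additively, e_{r+1} > n_r e_r ≥ m_r e_r + e_r, and by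
induction the last e_r exceeds the sum of the earlier m_j e_j. -/
theorem exists_lt_prod_of_lt_pow {Γ₀ : Type*} [LinearOrderedCommGroupWithZero Γ₀] {e : ℕ → Γ₀}
    {n m : ℕ → ℕ} (r : ℕ) (h0 : e 0 < 1) (hpos : ∀ j < r, 0 < e j)
    (hlt : ∀ j < r, e (j + 1) < e j ^ n j) (hm : ∀ j < r, m j < n j) :
    e r < ∏ j ∈ Finset.range r, e j ^ m j ∧ e r < 1 := by
  induction r with
  | zero => simpa using h0
  | succ r ih =>
    obtain ⟨ih1, ih2⟩ := ih (fun j hj => hpos j (by omega)) (fun j hj => hlt j (by omega))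
      (fun j hj => hm j (by omega))
    have h1 : e (r + 1) < e r ^ n r := hlt r (by omega)
    have h2 : e r ^ n r ≤ e r ^ (m r + 1) :=
      pow_le_pow_right_of_le_one' ih2.le (hm r (by omega))
    constructor
    · rw [Finset.prod_range_succ]
      refine (h1.trans_le h2).trans ?_
      rw [pow_succ, mul_comm]
      exact mul_lt_mul_of_pos_right ih1 (pow_pos (hpos r (by omega)) _)
    · exact (h1.trans_le h2).trans_le (pow_le_one' ih2.le _)

variable {K : Type*} [Field K] {Γ₀ : Type*} [LinearOrderedCommGroupWithZero Γ₀]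
  {ν : Valuation K Γ₀} {P : ℕ → K} {n : ℕ → ℕ}

/-- The order along the exceptional divisor of `P (j + 1)`, for `j ≥ 0`. -/
def order (n : ℕ → ℕ) (p j : ℕ) : ℕ := p * ∏ t ∈ Finset.Icc 1 j, n t

theorem order_succ (n : ℕ → ℕ) (p j : ℕ) : order n p (j + 1) = order n p j * n (j + 1) := by
  rw [order, order, Finset.prod_Icc_succ_top (by omega), mul_assoc]

/-- The order along the exceptional divisor of the monomial `monomial P (r + 2) σ`. -/
def monomialOrder (n : ℕ → ℕ) (p q r : ℕ) (σ : ℕ → ℕ) : ℕ :=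
  q * σ 0 + p * σ 1 + ∑ j ∈ Finset.range r, σ (j + 2) * order n p (j + 1)

theorem monomialOrder_succ (n : ℕ → ℕ) (p q r : ℕ) (σ : ℕ → ℕ) :
    monomialOrder n p q (r + 1) σ =
      monomialOrder n p q r σ + σ (r + 2) * order n p (r + 1) := by
  simp only [monomialOrder, Finset.sum_range_succ, add_assoc]

/-- The exponents of the transform of a monomial, after division by the `M`-th power of the
equation of the exceptional divisor. -/
def transformExp (n : ℕ → ℕ) (p q r M : ℕ) (σ : ℕ → ℕ) : ℕ → ℕ
  | 0 => monomialOrder n p q r σ - M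
  | j + 1 => σ (j + 2)

theorem monomial_succ (P : ℕ → K) (m : ℕ) (e : ℕ → ℕ) :
    monomial P (m + 1) e = monomial P m e * P m ^ e m := Finset.prod_range_succ _ _

theorem monomial_succ' (P : ℕ → K) (m : ℕ) (e : ℕ → ℕ) :
    monomial P (m + 1) e = P 0 ^ e 0 * ∏ j ∈ Finset.range m, P (j + 1) ^ e (j + 1) := by
  rw [monomial, Finset.prod_range_succ', mul_comm]

theorem monomial_ne_zero {P : ℕ → K} {m : ℕ} (hP : ∀ j < m, P j ≠ 0) (e : ℕ → ℕ) :
    monomial P m e ≠ 0 :=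
  Finset.prod_ne_zero_iff.2 fun j hj => pow_ne_zero _ (hP j (Finset.mem_range.1 hj))

/-- The elements `x₁` and `s` such that `x = x₁ ^ q * s ^ k` and `y = x₁ ^ p * s ^ l`, where `s`
is a unit of the valuation ring. -/
structure IsMonomialChange (ν : Valuation K Γ₀) (P : ℕ → K) (x₁ s : K) (p q : ℕ) (k l : ℤ) :
    Prop where
  val_s : ν s = 1
  x_ne : x₁ ≠ 0
  x_lt : ν x₁ < 1
  eq_zero : P 0 = x₁ ^ q * s ^ k
  eq_one : P 1 = x₁ ^ p * s ^ l
  p_pos : 0 < p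
  q_pos : 0 < q
  coprime : p.Coprime q
  s_eq : s = P 1 ^ q / P 0 ^ p

namespace IsMonomialChange

variable {x₁ s : K} {p q : ℕ} {k l : ℤ} (H : IsMonomialChange ν P x₁ s p q k l)
include H

theorem s_ne : s ≠ 0 := fun h => by simpa [h] using H.val_s

theorem val_zpow (m : ℤ) : ν (s ^ m) = 1 := by rw [map_zpow₀, H.val_s, one_zpow]

theorem eq_transformSeq (j : ℕ) :
    P (j + 2) = x₁ ^ order n p (j + 1) * transformSeq P n x₁ p (j + 1) := by
  have := H.x_ne
  rw [transformSeq, order]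
  field_simp

theorem monomial_eq (r : ℕ) (σ : ℕ → ℕ) : monomial P (r + 2) σ =
    s ^ (k * σ 0 + l * σ 1) * (x₁ ^ monomialOrder n p q r σ *
      ∏ j ∈ Finset.range r, transformSeq P n x₁ p (j + 1) ^ σ (j + 2)) := by
  induction r with
  | zero =>
    have hs := H.s_ne
    rw [monomial, Finset.prod_range_succ, Finset.prod_range_one, monomialOrder, H.eq_zero, H.eq_one,
      Finset.prod_range_zero, Finset.sum_range_zero, zpow_add₀ hs, zpow_mul, zpow_mul, zpow_natCast,
      zpow_natCast, mul_pow, mul_pow, ← pow_mul, ← pow_mul, add_zero, pow_add]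
    ring
  | succ r ih =>
    rw [show r + 1 + 2 = (r + 2) + 1 from rfl, monomial_succ, ih, monomialOrder_succ,
      H.eq_transformSeq (n := n) r, Finset.prod_range_succ, mul_pow, ← pow_mul, pow_add,
      mul_comm (order n p (r + 1))]
    ring

/-- The bound `hM` makes the natural-number subtraction in `transformExp` exact. -/
theorem monomial_eq_transformExp {r M : ℕ} {σ : ℕ → ℕ} (hM : M ≤ monomialOrder n p q r σ) :
    monomial P (r + 2) σ = s ^ (k * σ 0 + l * σ 1) *
      (x₁ ^ M * monomial (transformSeq P n x₁ p) (r + 1) (transformExp n p q r M σ)) := by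
  rw [H.monomial_eq (n := n), monomial_succ', transformExp, transformSeq]
  obtain ⟨m, hm⟩ := Nat.exists_eq_add_of_le hM
  rw [hm, Nat.add_sub_cancel_left, pow_add]
  simp only [transformExp]
  ring

theorem transformSeq_ne_zero {i : ℕ} (h : P (i + 1) ≠ 0) : transformSeq P n x₁ p i ≠ 0 := by
  cases i with
  | zero => exact H.x_ne
  | succ i => exact div_ne_zero h (pow_ne_zero _ H.x_ne)

theorem transformSeq_one_lt (h : ν (P 2) < ν (P 1) ^ n 1) : ν (transformSeq P n x₁ p 1) < 1 := by
  have hx : 0 < ν x₁ := (Valuation.pos_iff ν).2 H.x_ne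
  have h2 := H.eq_transformSeq (n := n) 0
  rw [h2, H.eq_one, map_mul, map_mul, H.val_zpow, mul_one, map_pow, map_pow, ← pow_mul,
    order_succ, order, Finset.Icc_eq_empty (by omega), Finset.prod_empty, mul_one] at h
  exact (mul_lt_iff_lt_one_right (pow_pos hx _)).1 h

theorem transformSeq_succ_lt {j : ℕ} (h : ν (P (j + 3)) < ν (P (j + 2)) ^ n (j + 2)) :
    ν (transformSeq P n x₁ p (j + 2)) < ν (transformSeq P n x₁ p (j + 1)) ^ n (j + 2) := by
  have hx : 0 < ν x₁ := (Valuation.pos_iff ν).2 H.x_ne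
  rw [H.eq_transformSeq (n := n) (j + 1), H.eq_transformSeq (n := n) j, map_mul, map_mul, map_pow,
    map_pow, mul_pow, ← pow_mul, order_succ n p (j + 1)] at h
  exact lt_of_mul_lt_mul_left h zero_le

theorem transformSeq_lt_prod {r : ℕ} (hne : ∀ j ≤ r + 2, P j ≠ 0)
    (hlt : ∀ j, 1 ≤ j → j ≤ r + 1 → ν (P (j + 1)) < ν (P j) ^ n j) {σ : ℕ → ℕ}
    (hσ : ∀ j < r, σ (j + 2) < n (j + 2)) :
    ν (transformSeq P n x₁ p (r + 1)) <
      ν (∏ j ∈ Finset.range r, transformSeq P n x₁ p (j + 1) ^ σ (j + 2)) ∧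
    ν (transformSeq P n x₁ p (r + 1)) < 1 := by
  rw [map_prod]
  simp only [map_pow]
  exact exists_lt_prod_of_lt_pow (e := fun j => ν (transformSeq P n x₁ p (j + 1)))
    (n := fun j => n (j + 2)) (m := fun j => σ (j + 2)) r
    (H.transformSeq_one_lt (hlt 1 le_rfl (by omega)))
    (fun j hj => (Valuation.pos_iff ν).2 (H.transformSeq_ne_zero (hne _ (by omega))))
    (fun j hj => H.transformSeq_succ_lt (hlt (j + 2) (by omega) (by omega))) hσ

/-- Additively, the part of the monomial in Q_1, …, Q_r has value below ν(Q_{r+1}) ≤ aν(Q_{r+1}).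
Since the total values agree, the monomial must make up the difference with more factors `x₁`. -/
theorem mul_order_lt_monomialOrder {r a : ℕ} (ha : 0 < a) (hne : ∀ j ≤ r + 2, P j ≠ 0)
    (hlt : ∀ j, 1 ≤ j → j ≤ r + 1 → ν (P (j + 1)) < ν (P j) ^ n j) {σ : ℕ → ℕ}
    (hσ : ∀ j < r, σ (j + 2) < n (j + 2))
    (hval : ν (P (r + 2) ^ a) = ν (monomial P (r + 2) σ)) :
    a * order n p (r + 1) < monomialOrder n p q r σ := by
  obtain ⟨h1, h2⟩ := H.transformSeq_lt_prod hne hlt hσ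
  have hx : 0 < ν x₁ := (Valuation.pos_iff ν).2 H.x_ne
  rw [H.monomial_eq (n := n), H.eq_transformSeq (n := n) r, map_mul, H.val_zpow, one_mul, map_pow,
    map_mul, map_mul, mul_pow, map_pow, map_pow, ← pow_mul] at hval
  by_contra hcon
  rw [not_lt] at hcon
  refine absurd hval (ne_of_lt ?_)
  calc ν x₁ ^ (order n p (r + 1) * a) * ν (transformSeq P n x₁ p (r + 1)) ^ a
      ≤ ν x₁ ^ monomialOrder n p q r σ * ν (transformSeq P n x₁ p (r + 1)) := by
        refine mul_le_mul' ?_ ?_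
        · exact pow_le_pow_right_of_le_one' H.x_lt.le (by rwa [mul_comm])
        · exact pow_le_of_le_one zero_le h2.le ha.ne'
    _ < _ := mul_lt_mul_of_pos_left h1 (pow_pos hx _)

/-- The power of `P (r + 2)` in the monomial cancels against the left side. A positive power remains
because its exponent is smaller than `n (r + 2)`. -/
theorem order_lt_monomialOrder_succ {r : ℕ} (hne : ∀ j ≤ r + 2, P j ≠ 0)
    (hlt : ∀ j, 1 ≤ j → j ≤ r + 1 → ν (P (j + 1)) < ν (P j) ^ n j) {σ : ℕ → ℕ}
    (hσ : ∀ j < r + 1, σ (j + 2) < n (j + 2))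
    (hval : ν (P (r + 2) ^ n (r + 2)) = ν (monomial P (r + 3) σ)) :
    order n p (r + 2) < monomialOrder n p q (r + 1) σ := by
  obtain ⟨a, ha⟩ := Nat.exists_eq_add_of_lt (hσ r (by omega))
  have hr : 0 < ν (P (r + 2)) := (Valuation.pos_iff ν).2 (hne _ le_rfl)
  have := H.mul_order_lt_monomialOrder (a := a + 1) (by omega) hne hlt
    (fun j hj => hσ j (by omega)) (by
      rw [monomial_succ, map_mul, ha, add_assoc, pow_add, map_mul, mul_comm, map_pow ν _ (σ _)]
        at hval
      exact mul_right_cancel₀ (pow_pos hr _).ne' hval)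
  rw [monomialOrder_succ, order_succ n p (r + 1), ha]
  have e : order n p (r + 1) * (σ (r + 2) + a + 1) =
      (a + 1) * order n p (r + 1) + σ (r + 2) * order n p (r + 1) := by ring
  rw [e]
  omega

end IsMonomialChange

end GenSeq

/-! ### Value groups, residue fields and step relations of the transformed sequence -/

namespace GenSeq

theorem _root_.Subgroup.zpowers_pow_sup_zpowers_pow {G : Type*} [CommGroup G] (g : G) {p q : ℕ}
    (h : p.Coprime q) :
    Subgroup.zpowers (g ^ q) ⊔ Subgroup.zpowers (g ^ p) = Subgroup.zpowers g := by
  apply le_antisymm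
  · rw [sup_le_iff, Subgroup.zpowers_le, Subgroup.zpowers_le]
    exact ⟨pow_mem (Subgroup.mem_zpowers g) _, pow_mem (Subgroup.mem_zpowers g) _⟩
  · rw [Subgroup.zpowers_le]
    have hb := Nat.gcd_eq_gcd_ab q p
    rw [Nat.Coprime.gcd_eq_one h.symm] at hb
    have : g = (g ^ q) ^ (q.gcdA p) * (g ^ p) ^ (q.gcdB p) := by
      rw [← zpow_natCast, ← zpow_natCast, ← zpow_mul, ← zpow_mul, ← zpow_add, ← hb]
      simp
    have hmem := mul_mem
      (Subgroup.mem_sup_left (T := Subgroup.zpowers (g ^ p))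
        (zpow_mem (Subgroup.mem_zpowers (g ^ q)) (q.gcdA p)))
      (Subgroup.mem_sup_right (S := Subgroup.zpowers (g ^ q))
        (zpow_mem (Subgroup.mem_zpowers (g ^ p)) (q.gcdB p)))
    rwa [← this] at hmem

theorem _root_.Subgroup.sup_zpowers_mul {G : Type*} [CommGroup G] {S : Subgroup G} {g : G}
    (hg : g ∈ S) (b : G) : S ⊔ Subgroup.zpowers (g * b) = S ⊔ Subgroup.zpowers b := by
  apply le_antisymm
  · rw [sup_le_iff, Subgroup.zpowers_le]
    exact ⟨le_sup_left, mul_mem (Subgroup.mem_sup_left hg)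
      (Subgroup.mem_sup_right (Subgroup.mem_zpowers b))⟩
  · rw [sup_le_iff, Subgroup.zpowers_le]
    refine ⟨le_sup_left, ?_⟩
    have h := mul_mem (Subgroup.mem_sup_left (inv_mem hg))
      (Subgroup.mem_sup_right (S := S) (Subgroup.mem_zpowers (g * b)))
    rwa [inv_mul_cancel_left] at h

open Polynomial in
-- The form of `minpoly_mul_eq` for equal subfields, whose coefficient types differ.
theorem minpoly_mul_eq_of_eq {L : Type*} [Field L] {E E' : Subfield L} (h : E' = E) {a a' γ : L}
    (hγ0 : γ ≠ 0) (hγ : γ ∈ E) (ha' : a' = a * γ) {d : ℕ} (hd : 1 ≤ d) {b : ℕ → E} {b' : ℕ → E'}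
    (hb' : ∀ t, (b' t : L) = b t * γ ^ (d - t))
    (hmin : minpoly E a = X ^ d + ∑ t ∈ Finset.range d, C (b t) * X ^ t) :
    minpoly E' a' = X ^ d + ∑ t ∈ Finset.range d, C (b' t) * X ^ t := by
  subst h
  have hb : b' = fun t => b t * (⟨γ, hγ⟩ : E') ^ (d - t) := funext fun t => Subtype.ext (hb' t)
  rw [ha', hb]
  exact minpoly_mul_eq (γ := (⟨γ, hγ⟩ : E')) (fun h0 => hγ0 (congrArg Subtype.val h0)) hd hmin

variable {K : Type*} [Field K] {Γ₀ : Type*} [LinearOrderedCommGroupWithZero Γ₀]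
  {ν : Valuation K Γ₀} {A : Subring K} {P : ℕ → K} {Ω : ℕ∞} {n : ℕ → ℕ} {w : ℕ → ℕ → ℕ}

namespace SatisfiesAlgorithm

variable (hP : SatisfiesAlgorithm ν A P Ω n w)
include hP

theorem ne_zero {i : ℕ} (hi : (i : ℕ∞) ≤ Ω) {j : ℕ} (hj : j ≤ i) : P j ≠ 0 :=
  (hP.mem j ((Nat.cast_le.2 hj).trans hi)).1

theorem lt_pow {i : ℕ} (hi : ((i + 1 : ℕ) : ℕ∞) ≤ Ω) {j : ℕ} (hj : 1 ≤ j) (hji : j ≤ i) :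
    ν (P (j + 1)) < ν (P j) ^ n j := by
  obtain ⟨-, lam, c, σ, d, b, -, -, -, -, -, h, -⟩ :=
    hP.step j hj (lt_of_lt_of_le (Nat.cast_lt.2 (by omega)) hi)
  exact h

end SatisfiesAlgorithm

/-- The exponents of the monomials `U i` of the transformed sequence. -/
noncomputable def transformW (ν : Valuation K Γ₀) (P : ℕ → K) (n : ℕ → ℕ) (w : ℕ → ℕ → ℕ)
    (p q : ℕ) : ℕ → ℕ → ℕ
  | 0 => 0
  | r + 1 => transformExp n p q r (nbar ν P (r + 2) * order n p (r + 1)) (w (r + 2))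

namespace IsMonomialChange

variable {x₁ s : K} {p q : ℕ} {k l : ℤ} (H : IsMonomialChange ν P x₁ s p q k l)
include H

/-- The values of `P 0` and `P 1` are q and p times that of `x₁`, so by coprimality they generate
the group of ν(x₁). Every later element changes only by a power of `x₁`. -/
theorem valueGroup_transformSeq {i : ℕ} (hne : ∀ j ≤ i + 1, P j ≠ 0) :
    valueGroup ν (transformSeq P n x₁ p) i = valueGroup ν P (i + 1) := by
  let ξ : Γ₀ˣ := Units.mk0 (ν x₁) ((Valuation.ne_zero_iff ν).2 H.x_ne)
  induction i with
  | zero =>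
    rw [valueGroup_zero (a := ξ) rfl, valueGroup_succ (a := ξ ^ p), valueGroup_zero (a := ξ ^ q),
      Subgroup.zpowers_pow_sup_zpowers_pow _ H.coprime]
    · rw [H.eq_zero, map_mul, H.val_zpow, mul_one, map_pow]; rfl
    · rw [H.eq_one, map_mul, H.val_zpow, mul_one, map_pow]; rfl
  | succ i ih =>
    have ih := ih fun j hj => hne j (by omega)
    let b : Γ₀ˣ := Units.mk0 (ν (transformSeq P n x₁ p (i + 1)))
      ((Valuation.ne_zero_iff ν).2 (H.transformSeq_ne_zero (hne _ le_rfl)))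
    have hξ : ξ ^ order n p (i + 1) ∈ valueGroup ν (transformSeq P n x₁ p) i :=
      pow_mem (Subgroup.subset_closure
        (show ξ ∈ {g : Γ₀ˣ | ∃ j ≤ i, (g : Γ₀) = ν (transformSeq P n x₁ p j)} from
          ⟨0, by omega, rfl⟩)) _
    rw [valueGroup_succ (a := b) rfl, valueGroup_succ (a := ξ ^ order n p (i + 1) * b), ← ih,
      Subgroup.sup_zpowers_mul hξ]
    rw [H.eq_transformSeq (n := n) i, map_mul, map_pow]; rfl

theorem nbar_transformSeq {i : ℕ} (hne : ∀ j ≤ i + 2, P j ≠ 0) :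
    nbar ν (transformSeq P n x₁ p) (i + 1) = nbar ν P (i + 2) := by
  rw [nbar, nbar, H.valueGroup_transformSeq hne, Nat.add_sub_cancel,
    H.valueGroup_transformSeq fun j hj => hne j (by omega)]
  rfl

variable (hP : SatisfiesAlgorithm ν A P Ω n w)
include hP

theorem U_eq {r : ℕ} (hr : ((r + 2 : ℕ) : ℕ∞) ≤ Ω) (h0 : nbar ν P (r + 2) ≠ 0) :
    U P w (r + 2) = s ^ (k * w (r + 2) 0 + l * w (r + 2) 1) *
      (x₁ ^ (nbar ν P (r + 2) * order n p (r + 1)) *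
        U (transformSeq P n x₁ p) (transformW ν P n w p q) (r + 1)) := by
  obtain ⟨h1, h2⟩ := hP.value_U (r + 2) (by omega) hr h0
  exact H.monomial_eq_transformExp (H.mul_order_lt_monomialOrder (Nat.pos_of_ne_zero h0)
    (fun j hj => hP.ne_zero hr hj) (fun j hj hj' => hP.lt_pow hr hj hj')
    (fun j hj => h1 _ (by omega) (by omega)) h2).le

theorem value_U_transformSeq {r : ℕ} (hr : ((r + 2 : ℕ) : ℕ∞) ≤ Ω) (h0 : nbar ν P (r + 2) ≠ 0) :
    ν (transformSeq P n x₁ p (r + 1) ^ nbar ν P (r + 2)) =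
      ν (U (transformSeq P n x₁ p) (transformW ν P n w p q) (r + 1)) := by
  obtain ⟨-, h2⟩ := hP.value_U (r + 2) (by omega) hr h0
  have hx : 0 < ν x₁ := (Valuation.pos_iff ν).2 H.x_ne
  rw [H.U_eq hP hr h0, H.eq_transformSeq (n := n) r, mul_pow, ← pow_mul,
    mul_comm (order n p (r + 1)), map_mul, map_mul, H.val_zpow, one_mul, map_mul, map_pow] at h2
  exact mul_left_cancel₀ (pow_pos hx _).ne' h2

/-- The powers of `x₁` in numerator and denominator cancel, and only a power of `s` from `U`
survives. -/
theorem alpha_transformSeq {r : ℕ} (hr : ((r + 2 : ℕ) : ℕ∞) ≤ Ω) (h0 : nbar ν P (r + 2) ≠ 0) :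
    alpha ν (transformSeq P n x₁ p) (transformW ν P n w p q) (r + 1) =
      alpha ν P w (r + 2) * resid ν s ^ (k * w (r + 2) 0 + l * w (r + 2) 1) := by
  have hne : ∀ j ≤ r + 2, P j ≠ 0 := fun j hj => hP.ne_zero hr hj
  obtain ⟨-, h2⟩ := hP.value_U (r + 2) (by omega) hr h0
  rw [alpha, alpha, H.nbar_transformSeq hne, if_neg h0, if_neg h0]
  have hν : ν (P (r + 2) ^ nbar ν P (r + 2) / U P w (r + 2)) = 1 := by
    rw [map_div₀, h2, div_self]
    rw [← h2, map_pow]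
    exact pow_ne_zero _ ((Valuation.ne_zero_iff ν).2 (hne _ le_rfl))
  rw [← resid_zpow H.val_s, ← resid_mul hν.le (H.val_zpow _).le]
  congr 1
  have hx := H.x_ne
  have hs := zpow_ne_zero (k * w (r + 2) 0 + l * w (r + 2) 1) H.s_ne
  have hU : U (transformSeq P n x₁ p) (transformW ν P n w p q) (r + 1) ≠ 0 :=
    monomial_ne_zero (fun j hj => H.transformSeq_ne_zero (hne _ (by omega))) _
  rw [H.U_eq hP hr h0, H.eq_transformSeq (n := n) r, mul_pow, ← pow_mul,
    mul_comm (order n p (r + 1))]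
  field_simp

/-- A new class is the old one times a power of the class of `s`, a nonzero element of the first
field of the tower, so both generate the same extension. For infinite index both classes are 1 by
convention. -/
theorem towerField_transformSeq {B : Subring K} (hB : baseField ν B = towerField ν A P w 1)
    (hs : resid ν s ∈ towerField ν A P w 1) {i : ℕ} (hi : ((i + 1 : ℕ) : ℕ∞) ≤ Ω) :
    towerField ν B (transformSeq P n x₁ p) (transformW ν P n w p q) i =
      towerField ν A P w (i + 1) := by
  induction i with
  | zero => rw [towerField_zero, hB]
  | succ i ih =>
    have ih := ih ((Nat.cast_le.2 (by omega)).trans hi)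
    rw [towerField_succ, towerField_succ (i + 1), ih]
    by_cases h0 : nbar ν P (i + 2) = 0
    · have hne : ∀ j ≤ i + 2, P j ≠ 0 := fun j hj => hP.ne_zero hi hj
      rw [alpha, alpha, H.nbar_transformSeq hne, if_pos h0, if_pos h0]
    · rw [H.alpha_transformSeq hP hi h0]
      set γ := resid ν s ^ (k * w (i + 2) 0 + l * w (i + 2) 1) with hγdef
      have hγ : γ ∈ towerField ν A P w (i + 1) :=
        zpow_mem (towerField_mono (by omega) hs) _
      have hγ0 : γ ≠ 0 := zpow_ne_zero _ (resid_ne_zero H.val_s)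
      apply le_antisymm
      · refine sup_le le_sup_left ?_
        rw [Subfield.closure_le, Set.singleton_subset_iff]
        exact mul_mem ((le_sup_right : Subfield.closure {alpha ν P w (i + 2)} ≤
          towerField ν A P w (i + 1) ⊔ _) (Subfield.subset_closure rfl))
          ((le_sup_left : towerField ν A P w (i + 1) ≤ _) hγ)
      · refine sup_le le_sup_left ?_
        rw [Subfield.closure_le, Set.singleton_subset_iff]
        have h := mul_mem ((le_sup_right : Subfield.closure {alpha ν P w (i + 2) * γ} ≤
          towerField ν A P w (i + 1) ⊔ _) (Subfield.subset_closure rfl))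
          ((le_sup_left : towerField ν A P w (i + 1) ≤ _) (inv_mem hγ))
        rwa [mul_inv_cancel_right₀ hγ0] at h

/-- The old relation is divided by the power of `x₁` contained in its leading term. Powers of `s`
enter the coefficients, which are therefore units of `B` but need not lie in `A`. -/
theorem isStep_transformSeq {B : Subring K} (hA : Dominates ν A) (hBd : Dominates ν B) (hAB : A ≤ B)
    (hsB : s ∈ B) (hB : baseField ν B = towerField ν A P w 1)
    (hs : resid ν s ∈ towerField ν A P w 1) {r : ℕ} (hr : ((r + 2 : ℕ) : ℕ∞) < Ω) :
    IsStep ν B (transformSeq P n x₁ p) (fun i => n (i + 1)) (transformW ν P n w p q) (r + 1) := by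
  obtain ⟨hn, lam, c, σ, d, b, hlam, hc, hPe, hσ, hval, hlt, hdvd, hd, hnd, hb, hmin⟩ :=
    hP.step (r + 2) (by omega) hr
  have hne : ∀ j ≤ r + 2, P j ≠ 0 := fun j hj => hP.ne_zero hr.le hj
  have hx := H.x_ne
  have hνx : 0 < ν x₁ := (Valuation.pos_iff ν).2 hx
  have hnb : nbar ν P (r + 2) ≠ 0 := by
    intro h0; rw [h0, zero_mul] at hnd; omega
  have hnbar := H.nbar_transformSeq (n := n) hne
  have hE := H.towerField_transformSeq hP hB hs (i := r)
    ((Nat.cast_le.2 (by omega : r + 1 ≤ r + 2)).trans hr.le)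
  have hcν : ∀ i, ν (c i) = 1 := fun i => by
    obtain ⟨hcA, hu⟩ := hc i
    exact (hA.isUnit_iff ⟨c i, hcA⟩).1 hu
  have hsν := H.val_zpow
  have hord : ∀ i, order n p (r + 2) < monomialOrder n p q (r + 1) (σ i) := fun i =>
    H.order_lt_monomialOrder_succ hne (fun j hj hj' => hP.lt_pow hr.le hj hj')
      (fun j hj => hσ i _ (by omega) (by omega)) (hval i)
  have hmon : ∀ i, monomial P (r + 3) (σ i) = s ^ (k * σ i 0 + l * σ i 1) *
      (x₁ ^ order n p (r + 2) * monomial (transformSeq P n x₁ p) (r + 2)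
        (transformExp n p q (r + 1) (order n p (r + 2)) (σ i))) :=
    fun i => H.monomial_eq_transformExp (hord i).le
  have hpow : P (r + 2) ^ n (r + 2) =
      x₁ ^ order n p (r + 2) * transformSeq P n x₁ p (r + 1) ^ n (r + 2) := by
    rw [H.eq_transformSeq (n := n) r, mul_pow, ← pow_mul, ← order_succ n p (r + 1)]
  set γ := resid ν s ^ (k * w (r + 2) 0 + l * w (r + 2) 1) with hγdef
  have hγ : γ ∈ towerField ν A P w (r + 1) := zpow_mem (towerField_mono (by omega) hs) _
  have hγ0 : γ ≠ 0 := zpow_ne_zero _ (resid_ne_zero H.val_s)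
  -- The class α is multiplied by γ, so the coefficient of X^t of its minimal polynomial is
  -- multiplied by γ^(d - t).
  let b' : ℕ → towerField ν B (transformSeq P n x₁ p) (transformW ν P n w p q) r := fun t =>
    ⟨b t * γ ^ (d - t), by rw [hE]; exact mul_mem (b t).2 (pow_mem hγ _)⟩
  refine ⟨hn, lam, fun i => c i * s ^ (k * σ i 0 + l * σ i 1),
    fun i => transformExp n p q (r + 1) (order n p (r + 2)) (σ i), d, b', hlam, ?_, ?_, ?_, ?_, ?_,
    ?_, hd, ?_, ?_, ?_⟩
  · intro i
    have hmem : c i * s ^ (k * σ i 0 + l * σ i 1) ∈ B :=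
      B.mul_mem (hAB (hc i).1) (hBd.zpow_mem hsB H.val_s _)
    refine ⟨hmem, (hBd.isUnit_iff ⟨_, hmem⟩).2 ?_⟩
    change ν (c i * _) = 1
    rw [map_mul, hcν, hsν, one_mul]
  · apply mul_left_cancel₀ (pow_ne_zero (order n p (r + 2)) hx)
    have h3 := H.eq_transformSeq (n := n) (r + 1)
    rw [← h3, hPe, hpow, mul_add, Finset.mul_sum]
    congr 1
    refine Finset.sum_congr rfl fun i _ => ?_
    rw [hmon]; ring
  · rintro i (_ | t) ht ht'
    · omega
    · exact hσ i (t + 2) (by omega) (by omega)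
  · intro i
    have h := hval i
    rw [hmon, hpow, map_mul, map_mul, hsν, one_mul, map_mul, map_pow] at h
    exact mul_left_cancel₀ (pow_pos hνx _).ne' h
  · exact H.transformSeq_succ_lt hlt
  · intro i
    rw [hnbar]
    exact hdvd i
  · rw [hnbar]; exact hnd
  · intro t ht
    rw [hnbar]
    change (b t : ResField ν) * γ ^ (d - t) = _
    have hQne : ∀ j < r + 1, transformSeq P n x₁ p j ≠ 0 :=
      fun j hj => H.transformSeq_ne_zero (hne _ (by omega))
    have hU0 : U (transformSeq P n x₁ p) (transformW ν P n w p q) (r + 1) ≠ 0 :=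
      monomial_ne_zero hQne _
    have hterm : ∀ i, σ i (r + 2) = t * nbar ν P (r + 2) →
        c i * s ^ (k * σ i 0 + l * σ i 1) * (monomial (transformSeq P n x₁ p) (r + 1)
          (transformExp n p q (r + 1) (order n p (r + 2)) (σ i)) /
          U (transformSeq P n x₁ p) (transformW ν P n w p q) (r + 1) ^ (d - t)) =
        c i * (monomial P (r + 2) (σ i) / U P w (r + 2) ^ (d - t)) *
          s ^ ((k * w (r + 2) 0 + l * w (r + 2) 1) * (d - t : ℕ)) := by
      intro i hi
      obtain ⟨e, rfl⟩ := Nat.exists_eq_add_of_lt ht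
      have hsub : t + e + 1 - t = e + 1 := by omega
      rw [hsub]
      -- The power of `x₁` removed from the relation is the part belonging to `U ^ (d - t)`, where d
      -- - t = e + 1, times the part belonging to the factor `P (r + 2) ^ (t * n̄)`.
      have hsplit : order n p (r + 2) = nbar ν P (r + 2) * order n p (r + 1) * (e + 1) +
          σ i (r + 2) * order n p (r + 1) := by
        rw [order_succ n p (r + 1), hnd, hi]; ring
      have hoi := hord i
      rw [monomialOrder_succ, hsplit] at hoi
      have hm := H.monomial_eq_transformExp (n := n) (r := r) (σ := σ i)
        (M := nbar ν P (r + 2) * order n p (r + 1) * (e + 1)) (by omega)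
      have hexp : transformExp n p q r (nbar ν P (r + 2) * order n p (r + 1) * (e + 1)) (σ i) =
          transformExp n p q (r + 1) (order n p (r + 2)) (σ i) := by
        funext j
        cases j with
        | zero =>
          simp only [transformExp]
          rw [monomialOrder_succ, hsplit]
          omega
        | succ j => rfl
      rw [hm, hexp, H.U_eq hP hr.le hnb, mul_pow, mul_pow, ← pow_mul, zpow_mul, zpow_natCast]
      have hs1 := zpow_ne_zero (k * w (r + 2) 0 + l * w (r + 2) 1) H.s_ne
      field_simp
    -- `resid` is multiplicative only on the valuation ring, so the sum has to be placed there
    -- before the factor in `s` is split off.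
    have hle : ∀ i, σ i (r + 2) = t * nbar ν P (r + 2) →
        ν (c i * (monomial P (r + 2) (σ i) / U P w (r + 2) ^ (d - t))) ≤ 1 := by
      intro i hi
      have hPne : 0 < ν (P (r + 2)) := (Valuation.pos_iff ν).2 (hne _ le_rfl)
      have h1 := hval i
      obtain ⟨-, h2⟩ := hP.value_U (r + 2) (by omega) hr.le hnb
      have hsplit : n (r + 2) = nbar ν P (r + 2) * (d - t) + t * nbar ν P (r + 2) := by
        obtain ⟨e, rfl⟩ := Nat.exists_eq_add_of_lt ht
        have hsub : t + e + 1 - t = e + 1 := by omega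
        rw [hnd, hsub]; ring
      rw [monomial_succ, hi, hsplit, pow_add, map_mul, map_mul] at h1
      have h3 := mul_right_cancel₀ (by rw [map_pow]; exact (pow_pos hPne _).ne') h1
      rw [map_mul, hcν, one_mul, map_div₀, ← h3, map_pow ν (U P w (r + 2)), ← h2, ← map_pow,
        ← pow_mul, div_self]
      rw [map_pow]; exact (pow_pos hPne _).ne'
    have hγpow : γ ^ (d - t) =
        resid ν (s ^ ((k * w (r + 2) 0 + l * w (r + 2) 1) * (d - t : ℕ))) := by
      rw [hγdef, zpow_mul, zpow_natCast, resid_pow (hsν _).le, resid_zpow H.val_s]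
    rw [hb t ht, hγpow, ← resid_mul (ν.map_sum_le fun i hi => hle i (Finset.mem_filter.1 hi).2) (hsν _).le,
      Finset.sum_mul]
    congr 1
    refine Finset.sum_congr rfl fun i hi => ?_
    exact (hterm i (Finset.mem_filter.1 hi).2).symm
  · exact minpoly_mul_eq_of_eq hE hγ0 hγ (H.alpha_transformSeq hP hr.le hnb) hd (fun _ => rfl) hmin

end IsMonomialChange

end GenSeq

/-! ### Linear independence over the larger residue field -/

namespace GenSeq

/-- Solve pb ≡ N modulo q with b < q. Then qa = N - pb ≥ pq(d - 1), which leaves room to subtract pt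
from a for every t < d. -/
theorem exists_mul_add_mul_eq {p q d N : ℕ} (hq : 0 < q) (h : p.Coprime q) (hd : 0 < d)
    (hN : p * q * d ≤ N) :
    ∃ a b, b < q ∧ q * a + p * b = N ∧ ∀ t < d, p * t ≤ a := by
  obtain ⟨b, hb, hmod⟩ : ∃ b < q, p * b ≡ N [MOD q] := by
    rcases Nat.lt_or_ge 1 q with h1 | h1
    · obtain ⟨u, -, hu⟩ := Nat.exists_mul_mod_eq_one_of_coprime h h1
      refine ⟨(u * N) % q, Nat.mod_lt _ hq, ?_⟩
      have e1 : p * ((u * N) % q) ≡ p * (u * N) [MOD q] := (Nat.mod_modEq _ _).mul_left p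
      have e2 : p * u ≡ 1 [MOD q] := by rw [Nat.ModEq, hu, Nat.mod_eq_of_lt h1]
      have e3 := e2.mul_right N
      rw [one_mul, mul_assoc] at e3
      exact e1.trans e3
    · obtain rfl : q = 1 := by omega
      exact ⟨0, by omega, Nat.modEq_one⟩
  obtain ⟨d, rfl⟩ := Nat.exists_eq_succ_of_ne_zero hd.ne'
  have hle : p * b + q * (p * d) ≤ N := by
    calc p * b + q * (p * d) ≤ p * q + q * (p * d) := by gcongr
      _ = p * q * (d + 1) := by ring
      _ ≤ N := hN
  have hle' : p * b ≤ N := by omega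
  obtain ⟨a, ha⟩ := (Nat.modEq_iff_dvd' hle').1 hmod
  refine ⟨a, b, hb, by omega, fun t ht => ?_⟩
  have : q * (p * d) ≤ q * a := by omega
  exact (Nat.mul_le_mul_left p (by omega)).trans (Nat.le_of_mul_le_mul_left this hq)

open Polynomial in
theorem exists_eq_sum_of_mem_sup_closure {L : Type*} [Field L] {E : Subfield L} {a : L} {d : ℕ}
    (hd : (minpoly E a).natDegree = d) (hd0 : 0 < d) {z : L} (hz : z ∈ E ⊔ Subfield.closure {a}) :
    ∃ μ : ℕ → E, z = ∑ t ∈ Finset.range d, (μ t : L) * a ^ t := by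
  have hint : IsIntegral E a := by
    by_contra hni
    rw [minpoly.eq_zero hni, natDegree_zero] at hd
    omega
  have hle : E ⊔ Subfield.closure {a} ≤ (IntermediateField.adjoin E {a}).toSubfield := by
    refine sup_le (fun e he => ?_) ?_
    · exact (IntermediateField.adjoin E {a}).algebraMap_mem ⟨e, he⟩
    · rw [Subfield.closure_le, Set.singleton_subset_iff]
      exact IntermediateField.mem_adjoin_simple_self E a
  have hz' : z ∈ (IntermediateField.adjoin E {a}).toSubalgebra := hle hz
  rw [IntermediateField.adjoin_simple_toSubalgebra_of_isAlgebraic hint.isAlgebraic,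
    Algebra.adjoin_singleton_eq_range_aeval] at hz'
  obtain ⟨G, rfl⟩ := hz'
  have hmonic := minpoly.monic hint
  have hne : minpoly E a ≠ 1 := fun h1 => by
    rw [h1, natDegree_one] at hd; omega
  have hdeg := natDegree_modByMonic_lt G hmonic hne
  rw [hd] at hdeg
  refine ⟨fun t => (G %ₘ minpoly E a).coeff t, ?_⟩
  have hev : aeval a G = aeval a (G %ₘ minpoly E a) := by
    conv_lhs => rw [← modByMonic_add_div G (minpoly E a)]
    rw [map_add, map_mul, minpoly.aeval, zero_mul, add_zero]
  change aeval a G = _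
  rw [hev, aeval_eq_sum_range' hdeg]
  rfl

variable {K : Type*} [Field K] {Γ₀ : Type*} [LinearOrderedCommGroupWithZero Γ₀]
  {ν : Valuation K Γ₀} {A : Subring K} {P : ℕ → K} {n : ℕ → ℕ}

/-- Replacing the denominator by any `z` of the common value multiplies all the classes by one
nonzero class. The index type may be any finite type, including an empty one. -/
theorem MonomialsIndependent.linearIndependent {r : ℕ} (h : MonomialsIndependent ν A P n r)
    {ι : Type*} [Fintype ι] (e : ι → ℕ → ℕ) {z : K} (hz : z ≠ 0)
    (he : ∀ i s, 1 ≤ s → s ≤ r → e i s < n s) (hne : ∀ i i', i ≠ i' → ∃ s ≤ r, e i s ≠ e i' s)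
    (hν : ∀ i, ν (monomial P (r + 1) (e i)) = ν z) :
    LinearIndependent (baseField ν A) fun i => resid ν (monomial P (r + 1) (e i) / z) := by
  have hνz : ν z ≠ 0 := (Valuation.ne_zero_iff ν).2 hz
  obtain ⟨f⟩ : Nonempty (ι ≃ Fin (Fintype.card ι)) := ⟨Fintype.equivFin ι⟩
  rcases hm : Fintype.card ι with _ | m
  · have := Fintype.card_eq_zero_iff.1 hm
    exact linearIndependent_empty_type
  rw [hm] at f
  rw [← linearIndependent_equiv f.symm]
  have h1 := h m (fun l => e (f.symm l)) (fun l => he _)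
    (fun l l' hl => hne _ _ fun hc => hl (f.symm.injective hc))
    (fun l => (hν _).trans (hν _).symm)
  have h0ν := hν (f.symm 0)
  have h00 : monomial P (r + 1) (e (f.symm 0)) ≠ 0 := fun h0 => by
    rw [h0, map_zero] at h0ν; exact hνz h0ν.symm
  have hc : ν (monomial P (r + 1) (e (f.symm 0)) / z) = 1 := by
    rw [map_div₀, h0ν, div_self hνz]
  have hfun : ((fun i => resid ν (monomial P (r + 1) (e i) / z)) ∘ f.symm) = fun l =>
      resid ν (monomial P (r + 1) (e (f.symm l)) / monomial P (r + 1) (e (f.symm 0))) *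
        resid ν (monomial P (r + 1) (e (f.symm 0)) / z) := by
    funext l
    rw [← resid_mul _ hc.le, div_mul_div_cancel₀ h00]
    · rfl
    · rw [map_div₀, hν, h0ν, div_self hνz]
  rw [hfun, Fintype.linearIndependent_iff]
  rw [Fintype.linearIndependent_iff] at h1
  intro g hg
  refine h1 g ?_
  simp only [← smul_mul_assoc] at hg
  rw [← Finset.sum_mul] at hg
  exact (mul_eq_zero.1 hg).resolve_right (resid_ne_zero hc)

/-- The exponents of a monomial in `P` whose transform has the exponents `e`. -/
def liftExp (a b : ℕ) (e : ℕ → ℕ) : ℕ → ℕ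
  | 0 => a
  | 1 => b
  | j + 2 => e (j + 1)

/-- Replacing the exponents (a, b) of `P 0`, `P 1` by (a - pt, b + qt) keeps the order in `x₁` and
multiplies by s^t. Each monomial in Q thus comes from d monomials in P. Expanding coefficients in 1,
α, …, α^(d-1), for α the class of `s`, turns a relation over 𝔨(α) into one over 𝔨. -/
theorem IsMonomialChange.monomialsIndependent_transformSeq {x₁ s : K} {p q : ℕ} {k l : ℤ}
    (H : IsMonomialChange ν P x₁ s p q k l) {B : Subring K} {d : ℕ} (hd0 : 0 < d)
    (hB : baseField ν B = baseField ν A ⊔ Subfield.closure {resid ν s})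
    (hd : (minpoly (baseField ν A) (resid ν s)).natDegree = d) (hn : n 1 = q * d) {r : ℕ}
    (hne : ∀ j ≤ r + 1, P j ≠ 0) (hP : MonomialsIndependent ν A P n (r + 1)) :
    MonomialsIndependent ν B (transformSeq P n x₁ p) (fun i => n (i + 1)) r := by
  intro m j hj hjne hjν
  set Q := transformSeq P n x₁ p with hQ
  have hQ0 : ∀ l, monomial Q (r + 1) (j l) ≠ 0 := fun l =>
    monomial_ne_zero (fun i hi => H.transformSeq_ne_zero (hne _ (by omega))) _
  have hs0 := H.s_ne
  have hα0 : resid ν s ≠ 0 := resid_ne_zero H.val_s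
  -- `S l` is the order in `x₁` contributed by `P 2`, …, `P (r + 1)`. The rest, `N + j l 0 - S l`,
  -- must come from `P 0` and `P 1`, and `N` is chosen large enough for `exists_mul_add_mul_eq` to
  -- apply to every `l`.
  let S : Fin (m + 1) → ℕ := fun l => ∑ i ∈ Finset.range r, j l (i + 1) * order n p (i + 1)
  let N := ∑ l, S l + p * q * d
  have hSN : ∀ l, S l + p * q * d ≤ N := fun l =>
    Nat.add_le_add_right (Finset.single_le_sum (f := S) (fun _ _ => Nat.zero_le _)
      (Finset.mem_univ l)) _
  have hab : ∀ l, ∃ a b, b < q ∧ q * a + p * b = N + j l 0 - S l ∧ ∀ t < d, p * t ≤ a := fun l =>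
    exists_mul_add_mul_eq H.q_pos H.coprime hd0 (by have := hSN l; omega)
  choose a b hbq hR hat using hab
  let f : Fin (m + 1) → ℤ := fun i => k * a i + l * b i
  let σ : Fin (m + 1) × Fin d → ℕ → ℕ := fun i =>
    liftExp (a i.1 - p * i.2) (b i.1 + q * i.2) (j i.1)
  -- The definition of `s` gives this directly; the integer lq - kp itself need not be known.
  have hspow : s ^ (l * q - k * p) = s := by
    conv_rhs => rw [H.s_eq, H.eq_zero, H.eq_one]
    have hx := H.x_ne
    have hs2 : (s ^ k) ^ p ≠ 0 := pow_ne_zero _ (zpow_ne_zero _ hs0)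
    rw [zpow_sub₀ hs0, zpow_mul, zpow_mul, zpow_natCast, zpow_natCast, mul_pow, mul_pow, ← pow_mul,
      ← pow_mul, mul_comm p q]
    field_simp
  have hmon : ∀ i, monomial P (r + 2) (σ i) =
      s ^ (f i.1) * s ^ (i.2 : ℕ) * (x₁ ^ N * monomial Q (r + 1) (j i.1)) := by
    rintro ⟨i, t⟩
    have hpt := hat i t t.2
    have hord : monomialOrder n p q r (σ (i, t)) = N + j i 0 := by
      have h1 := hR i
      have h2 := hSN i
      have h3 : monomialOrder n p q r (σ (i, t)) =
          q * (a i - p * t) + p * (b i + q * t) + S i := rfl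
      obtain ⟨c, hc⟩ := Nat.exists_eq_add_of_le hpt
      rw [h3, hc, Nat.add_sub_cancel_left]
      rw [hc] at h1
      have h4 : q * c + p * (b i + q * t) = q * (p * t + c) + p * b i := by ring
      rw [h4]; omega
    have hexp : transformExp n p q r N (σ (i, t)) = j i := by
      funext u
      cases u with
      | zero => rw [transformExp, hord, Nat.add_sub_cancel_left]
      | succ u => rfl
    rw [H.monomial_eq_transformExp (n := n) (M := N) (by omega), hexp]
    congr 1
    have hcast : k * (σ (i, t) 0 : ℤ) + l * (σ (i, t) 1 : ℤ) = f i + (l * q - k * p) * (t : ℕ) := by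
      change k * ((a i - p * t : ℕ) : ℤ) + l * ((b i + q * t : ℕ) : ℤ) = _
      rw [Nat.cast_sub hpt]
      push_cast
      ring
    rw [hcast, zpow_add₀ hs0, zpow_mul s (l * q - k * p), hspow, zpow_natCast]
  set z := s ^ f 0 * (x₁ ^ N * monomial Q (r + 1) (j 0)) with hzdef
  have hz : z ≠ 0 := mul_ne_zero (zpow_ne_zero _ hs0)
    (mul_ne_zero (pow_ne_zero _ H.x_ne) (hQ0 0))
  have hind := hP.linearIndependent σ hz (by
      rintro ⟨i, t⟩ (_ | _ | u) hu hu'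
      · omega
      · change b i + q * t < n 1
        rw [hn]
        calc b i + q * t < q + q * t := by have := hbq i; omega
          _ = q * (t + 1) := by ring
          _ ≤ q * d := Nat.mul_le_mul_left q t.2
      · exact hj i (u + 1) (by omega) (by omega)) (by
      rintro ⟨i, t⟩ ⟨i', t'⟩ hii
      by_contra! hcon
      have h0 : a i - p * t = a i' - p * t' := hcon 0 (by omega)
      have h1 : b i + q * t = b i' + q * t' := hcon 1 (by omega)
      have h2 : ∀ u, u + 1 ≤ r → j i (u + 1) = j i' (u + 1) := fun u hu =>
        hcon (u + 2) (by omega)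
      -- Since b < q, the numbers t and b are the quotient and remainder of b + qt by q.
      have ht : (t : ℕ) = t' := by
        have := congrArg (· / q) h1
        simpa [Nat.add_mul_div_left _ _ H.q_pos, Nat.div_eq_of_lt (hbq _)] using this
      have hb : b i = b i' := by rw [ht] at h1; omega
      have ha : a i = a i' := by
        have e1 := hat i t t.2
        have e2 := hat i' t' t'.2
        rw [ht] at h0 e1
        omega
      have hS : S i = S i' := Finset.sum_congr rfl fun u hu => by
        rw [h2 u (by have := Finset.mem_range.1 hu; omega)]
      have hj0 : j i 0 = j i' 0 := by
        have e1 := hR i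
        have e2 := hR i'
        have e3 := hSN i
        rw [ha, hb, e2, hS] at e1
        rw [hS] at e3
        omega
      have hi : i = i' := by
        by_contra hne'
        obtain ⟨u, hu, hun⟩ := hjne i i' hne'
        cases u with
        | zero => exact hun hj0
        | succ u => exact hun (h2 u hu)
      exact hii (Prod.ext hi (Fin.ext ht))) (by
      rintro ⟨i, t⟩
      rw [hmon, hzdef, map_mul, map_mul, map_mul ν (x₁ ^ N), hjν i, map_mul, H.val_zpow, H.val_zpow,
        map_pow, H.val_s, one_pow, mul_one, map_mul])
  have hV : ∀ i, ν (monomial Q (r + 1) (j i) / monomial Q (r + 1) (j 0)) = 1 := fun i => by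
    rw [map_div₀, hjν, div_self ((Valuation.ne_zero_iff ν).2 (hQ0 0))]
  have hres : ∀ i, resid ν (monomial P (r + 2) (σ i) / z) = resid ν s ^ (i.2 : ℕ) *
      (resid ν s ^ (f i.1 - f 0) *
        resid ν (monomial Q (r + 1) (j i.1) / monomial Q (r + 1) (j 0))) := by
    rintro ⟨i, t⟩
    have hQ00 := hQ0 0
    have hx := H.x_ne
    have h1 : monomial P (r + 2) (σ (i, t)) / z = s ^ (t : ℕ) * (s ^ (f i - f 0) *
        (monomial Q (r + 1) (j i) / monomial Q (r + 1) (j 0))) := by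
      rw [hmon, hzdef, zpow_sub₀ hs0]
      have := zpow_ne_zero (f 0) hs0
      field_simp
    rw [h1, resid_mul (by rw [map_pow, H.val_s, one_pow])
      (by rw [map_mul, H.val_zpow, hV, mul_one]), resid_mul (H.val_zpow _).le (hV i).le,
      resid_pow H.val_s.le, resid_zpow H.val_s]
  rw [Fintype.linearIndependent_iff] at hind ⊢
  intro g hg i
  -- The coefficient is divided by the power with exponent `f i - f 0` before it is expanded,
  -- because `hres` attaches exactly this factor to the monomials in P.
  have hμ : ∀ i, ∃ μ : ℕ → baseField ν A, (g i : ResField ν) * resid ν s ^ (-(f i - f 0)) =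
      ∑ t ∈ Finset.range d, (μ t : ResField ν) * resid ν s ^ t := fun i => by
    refine exists_eq_sum_of_mem_sup_closure hd hd0 ?_
    rw [← hB]
    refine mul_mem (g i).2 (zpow_mem ?_ _)
    rw [hB]
    exact (le_sup_right : Subfield.closure {resid ν s} ≤ baseField ν A ⊔ _)
      (Subfield.subset_closure rfl)
  choose μ hμ using hμ
  have hgi : ∀ i, (g i : ResField ν) =
      (∑ t : Fin d, (μ i t : ResField ν) * resid ν s ^ (t : ℕ)) * resid ν s ^ (f i - f 0) := by
    intro i
    rw [Fin.sum_univ_eq_sum_range (fun t => (μ i t : ResField ν) * resid ν s ^ t), ← hμ i,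
      mul_assoc, ← zpow_add₀ hα0, neg_add_cancel, zpow_zero, mul_one]
  have hzero := hind (fun i => μ i.1 i.2) (by
    rw [Fintype.sum_prod_type]
    refine Eq.trans (Finset.sum_congr rfl fun i _ => ?_) hg
    change _ = (g i : ResField ν) * _
    rw [hgi i, Finset.sum_mul, Finset.sum_mul]
    refine Finset.sum_congr rfl fun t _ => ?_
    rw [hres]
    change (μ i t : ResField ν) * _ = _
    ring)
  apply Subtype.ext
  rw [hgi i, Finset.sum_eq_zero fun t _ => ?_, zero_mul]
  · rfl
  · have := hzero (i, t)
    simp only at this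
    rw [this, ZeroMemClass.coe_zero, zero_mul]

end GenSeq

/-! ### The form of `P 2` and the conclusions for the transformed sequence -/

namespace GenSeq

theorem _root_.ENat.add_one_le_of_le_sub_one {a : ℕ∞} (ha : 2 ≤ a) {i : ℕ} (h : (i : ℕ∞) ≤ a - 1) :
    ((i + 1 : ℕ) : ℕ∞) ≤ a := by
  induction a using ENat.recTopCoe with
  | top => exact le_top
  | coe a =>
    have h2 : 2 ≤ a := by exact_mod_cast ha
    have h' : i ≤ a - 1 := by exact_mod_cast h
    exact_mod_cast (by omega : i + 1 ≤ a)

theorem _root_.ENat.add_one_lt_of_lt_sub_one {a : ℕ∞} {i : ℕ} (h : (i : ℕ∞) < a - 1) :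
    ((i + 1 : ℕ) : ℕ∞) < a := by
  induction a using ENat.recTopCoe with
  | top => exact ENat.natCast_lt_top _
  | coe a =>
    have h' : i < a - 1 := by exact_mod_cast h
    exact_mod_cast (by omega : i + 1 < a)

theorem _root_.ENat.eq_add_one_of_sub_one_eq {a : ℕ∞} (ha : 2 ≤ a) {i : ℕ} (h : a - 1 = i) :
    a = (i + 1 : ℕ) ∧ 1 ≤ i := by
  induction a using ENat.recTopCoe with
  | top => exact absurd h (by simp)
  | coe a =>
    have h2 : 2 ≤ a := by exact_mod_cast ha
    have h' : a - 1 = i := by exact_mod_cast h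
    exact ⟨by exact_mod_cast (by omega : a = i + 1), by omega⟩

variable {K : Type*} [Field K] {Γ₀ : Type*} [LinearOrderedCommGroupWithZero Γ₀]
  {ν : Valuation K Γ₀} {A : Subring K} {P : ℕ → K} {Ω : ℕ∞} {n : ℕ → ℕ} {w : ℕ → ℕ → ℕ}

open Polynomial in
/-- The element `P 2` is, up to a power of `P 0`, the value at `s` of a monic polynomial. -/
theorem exists_monic_eq_mul_aeval {T : Subring K} {s : K} {p q d lam : ℕ} {c : Fin lam → K}
    {σ : Fin lam → ℕ → ℕ} (hc : ∀ j, c j ∈ T) (h0 : P 0 ≠ 0) (h1 : ν (P 0) < 1)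
    (hpq : P 1 ^ q = P 0 ^ p * s) (hs : ν s = 1) (hq : 0 < q)
    (hP : P 2 = P 1 ^ (q * d) + ∑ j, c j * GenSeq.monomial P 2 (σ j))
    (hσ : ∀ j, σ j 1 < q * d) (hval : ∀ j, ν (P 1 ^ (q * d)) = ν (GenSeq.monomial P 2 (σ j)))
    (hdvd : ∀ j, q ∣ σ j 1) :
    ∃ F : Polynomial T, F.Monic ∧ F.natDegree = d ∧ P 2 = P 0 ^ (p * d) * aeval s F := by
  have hν0 : 0 < ν (P 0) := (Valuation.pos_iff ν).2 h0
  let G : Polynomial T := ∑ j, C (⟨c j, hc j⟩ : T) * X ^ (σ j 1 / q)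
  have hG : G.degree < d := by
    refine (degree_sum_le _ _).trans_lt ((Finset.sup_lt_iff (WithBot.bot_lt_coe d)).2 fun j _ => ?_)
    refine (degree_C_mul_X_pow_le _ _).trans_lt (Nat.cast_lt.2 ?_)
    rw [Nat.div_lt_iff_lt_mul hq, mul_comm]
    exact hσ j
  refine ⟨X ^ d + G, monic_X_pow_add hG, ?_, ?_⟩
  · rw [natDegree_add_eq_left_of_degree_lt (by rwa [degree_X_pow]), natDegree_X_pow]
  have hFs : aeval s (X ^ d + G) = s ^ d + ∑ j, c j * s ^ (σ j 1 / q) := by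
    simp only [G, map_add, map_pow, aeval_X, map_sum, map_mul, aeval_C]
    rfl
  rw [hFs, hP, pow_mul (P 1), hpq, mul_pow, ← pow_mul, mul_add, Finset.mul_sum]
  congr 1
  refine Finset.sum_congr rfl fun j _ => ?_
  obtain ⟨t, ht⟩ := hdvd j
  have hdt : σ j 1 / q = t := by rw [ht, Nat.mul_div_cancel_left _ hq]
  have hmon : GenSeq.monomial P 2 (σ j) = P 0 ^ (σ j 0 + p * t) * s ^ t := by
    rw [GenSeq.monomial, Finset.prod_range_succ, Finset.prod_range_one, ht, pow_mul, hpq, mul_pow,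
      pow_add, pow_mul]
    ring
  -- Powers of ν(P 0) < 1 are distinct, so the equality of values fixes the exponent of `P 0`.
  have he : σ j 0 + p * t = p * d := by
    have hv := hval j
    rw [hmon, pow_mul (P 1), hpq, mul_pow, ← pow_mul, map_mul, map_mul, map_pow, map_pow, map_pow,
      map_pow, hs, one_pow, one_pow, mul_one, mul_one] at hv
    exact (pow_right_injective₀ hν0 h1.ne hv).symm
  rw [hmon, he, hdt]
  ring

namespace IsMonomialChange

variable {x₁ s : K} {p q : ℕ} {k l : ℤ} (H : IsMonomialChange ν P x₁ s p q k l)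
  (hP : SatisfiesAlgorithm ν A P Ω n w)
include H hP

/-- Each step relation expresses the next element as a polynomial over `B` in the earlier ones, so
only the first two memberships need a separate argument. -/
theorem transformSeq_mem {B : Subring K} (hA : Dominates ν A) (hBd : Dominates ν B) (hAB : A ≤ B)
    (hsB : s ∈ B) (hB : baseField ν B = towerField ν A P w 1)
    (hs : resid ν s ∈ towerField ν A P w 1) (h0 : x₁ ∈ B) (h1 : transformSeq P n x₁ p 1 ∈ B)
    {i : ℕ} (hi : ((i + 1 : ℕ) : ℕ∞) ≤ Ω) : transformSeq P n x₁ p i ∈ B := by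
  induction i using Nat.strong_induction_on with
  | _ i ih =>
    rcases i with _ | _ | r
    · exact h0
    · exact h1
    · obtain ⟨-, lam, c, σ, -, -, -, hc, hQ, -⟩ := H.isStep_transformSeq hP hA hBd hAB hsB hB hs
        (r := r) (lt_of_lt_of_le (Nat.cast_lt.2 (by omega)) hi)
      have hmem : ∀ j < r + 2, transformSeq P n x₁ p j ∈ B := fun j hj =>
        ih j hj ((Nat.cast_le.2 (by omega)).trans hi)
      rw [hQ]
      refine B.add_mem (B.pow_mem (hmem _ (by omega)) _) (B.sum_mem fun j _ => ?_)
      exact B.mul_mem (hc j).1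
        (B.prod_mem fun u hu => B.pow_mem (hmem u (Finset.mem_range.1 hu)) _)

theorem satisfiesAlgorithm_transformSeq {B : Subring K} (hA : Dominates ν A)
    (hBd : Dominates ν B) (hAB : A ≤ B) (hsB : s ∈ B) {d : ℕ} (hd0 : 0 < d)
    (hB : baseField ν B = towerField ν A P w 1) (hα : alpha ν P w 1 = resid ν s)
    (hd : (minpoly (baseField ν A) (resid ν s)).natDegree = d) (hn : n 1 = q * d)
    (h0 : x₁ ∈ B) (h1 : transformSeq P n x₁ p 1 ∈ B) (hΩ : 2 ≤ Ω) :
    SatisfiesAlgorithm ν B (transformSeq P n x₁ p) (Ω - 1) (fun i => n (i + 1))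
      (transformW ν P n w p q) := by
  have hs : resid ν s ∈ towerField ν A P w 1 := hα ▸ alpha_mem_towerField le_rfl le_rfl
  have hne : ∀ {i : ℕ}, ((i + 1 : ℕ) : ℕ∞) ≤ Ω → ∀ j ≤ i + 1, P j ≠ 0 :=
    fun hi j hj => hP.ne_zero hi hj
  constructor
  · induction Ω using ENat.recTopCoe with
    | top => exact le_top
    | coe a =>
      have h2 : 2 ≤ a := by exact_mod_cast hΩ
      exact_mod_cast (by omega : 1 ≤ a - 1)
  · intro i hi
    have hi' := ENat.add_one_le_of_le_sub_one hΩ hi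
    refine ⟨H.transformSeq_ne_zero (hne hi' _ le_rfl),
      H.transformSeq_mem hP hA hBd hAB hsB hB hs h0 h1 hi', ?_⟩
    rw [← (hBd _).2]
    cases i with
    | zero => exact H.x_lt
    | succ r =>
      exact (H.transformSeq_lt_prod (σ := 0) (hne hi') (fun j hj hj' => hP.lt_pow hi' hj hj')
        fun j hj => (hP.step (j + 2) (by omega)
          (lt_of_lt_of_le (Nat.cast_lt.2 (by omega)) hi')).1).2
  · rintro (_ | r) hr hr'
    · omega
    · exact H.isStep_transformSeq hP hA hBd hAB hsB hB hs (ENat.add_one_lt_of_lt_sub_one hr')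
  · intro r hr
    have hr' := ENat.add_one_lt_of_lt_sub_one hr
    refine H.monomialsIndependent_transformSeq hd0 ?_ hd hn (hne hr'.le) (hP.independent _ hr')
    rw [hB, towerField_succ, towerField_zero, hα]
  · rintro (_ | r) hr hr' hnb
    · omega
    · have hr2 := ENat.add_one_le_of_le_sub_one hΩ hr'
      rw [H.nbar_transformSeq (hne hr2)] at hnb ⊢
      refine ⟨?_, H.value_U_transformSeq hP hr2 hnb⟩
      rintro (_ | j) hj hj'
      · omega
      · exact (hP.value_U (r + 2) (by omega) hr2 hnb).1 (j + 2) (by omega) (by omega)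
  · intro N hN
    obtain ⟨hN', hN1⟩ := ENat.eq_add_one_of_sub_one_eq hΩ hN
    obtain ⟨r, rfl⟩ := Nat.exists_eq_succ_of_ne_zero (by omega : N ≠ 0)
    rw [Nat.succ_eq_add_one] at hN' ⊢
    have hle : ((r + 1 + 1 : ℕ) : ℕ∞) ≤ Ω := hN'.ge
    rw [H.nbar_transformSeq (hne hle), H.towerField_transformSeq hP hB hs hle, Nat.add_sub_cancel,
      H.towerField_transformSeq hP hB hs (i := r) ((Nat.cast_le.2 (by omega)).trans hle)]
    exact hP.terminates _ hN'

end IsMonomialChange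

end GenSeq

/-! ### The main theorem -/

theorem theorem7p1 {K : Type*} [Field K] {Γ₀ : Type*} [LinearOrderedCommGroupWithZero Γ₀]
    (ν : Valuation K Γ₀) (R : Subring K) [IsFractionRing R K] (hν : Dominates ν R)
    (x y : K) (hxy : IsRegularParameters R x y)
    (P : ℕ → K) (Ω : ℕ∞) (n : ℕ → ℕ) (w : ℕ → ℕ → ℕ)
    (hP0 : P 0 = x) (hP1 : P 1 = y) (hP : SatisfiesAlgorithm ν R P Ω n w) (hΩ : 2 ≤ Ω) :
    -- there is a smallest `i` such that the divisor of `xy` in `T i` has only one component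
    ∃ i : ℕ, IsLeast {i : ℕ | 1 ≤ i ∧ DivisorHasOneComponent (quadraticSeq ν R i) (x * y)} i ∧
    ∃ R₁ : Subring K, R₁ = quadraticSeq ν R i ∧ Dominates ν R₁ ∧
      -- the residue field of `R₁` is `𝔨(α 1)`, compatibly with the maps to `L`
      (∃ (_ : IsLocalRing R₁) (φ : IsLocalRing.ResidueField R₁ ≃+* towerField ν R P w 1),
        ∀ f : R₁, ((φ (IsLocalRing.residue R₁ f) : towerField ν R P w 1) : ResField ν) =
          resid ν (f : K)) ∧
      -- the exceptional divisor, the regular parameters, and the new sequence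
      ∃ (x₁ : K) (e : ℕ), 0 < e ∧
        IsExceptionalEquation R R₁ x₁ ∧
        IsRegularParameters R₁ x₁ (P 2 / x₁ ^ (e * n 1)) ∧
        ∃ w' : ℕ → ℕ → ℕ,
          SatisfiesAlgorithm ν R₁ (transformSeq P n x₁ e) (Ω - 1) (fun i => n (i + 1)) w' := by
  obtain ⟨hn, lam, c, σ, d, b, hlam, hc, hPe, hσ, hval, hlt, hdvd, hd, hnd, hb, hmin⟩ :=
    hP.step 1 le_rfl (lt_of_lt_of_le (by norm_num) hΩ)
  have hx0 : x ≠ 0 := hxy.left_ne_zero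
  have hy0 : y ≠ 0 := hxy.symm.left_ne_zero
  have hνx : 0 < ν x := (Valuation.pos_iff ν).2 hx0
  have hx1 := hxy.lt_one hν
  have hy1 := hxy.symm.lt_one hν
  -- An infinite index is encoded by 0, which n 1 ≥ 1 excludes.
  have hnb : nbar ν P 1 ≠ 0 := by
    intro h0; rw [h0, zero_mul] at hnd; omega
  obtain ⟨-, hU⟩ := hP.value_U 1 le_rfl hP.one_le hnb
  have hUe : U P w 1 = x ^ w 1 0 := by rw [U, monomial, Finset.prod_range_one, hP0]
  set q := nbar ν P 1 with hq
  set p := w 1 0 with hp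
  rw [hUe, hP1, map_pow, map_pow] at hU
  have hq0 : 0 < q := Nat.pos_of_ne_zero hnb
  have hp0 : 0 < p := Nat.pos_of_ne_zero fun h0 => by
    rw [h0, pow_zero] at hU
    exact (pow_lt_one₀ zero_le hy1 hnb).ne hU
  have hpq : p.Coprime q := coprime_of_pow_nbar_eq (hP0 ▸ hx0) (hP1 ▸ hy0) hnb (by
    rw [hP0, hP1]; exact hU)
  obtain ⟨i, x₁, k, l, hx, hy, hreg, hdomT, hRT, hbT, hj⟩ :=
    exists_quadraticSeq_isRegularParameters p q hp0 hq0 hpq hν hxy hU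
  set s := y ^ q / x ^ p with hs
  set T := quadraticSeq ν R i with hT
  have hsν : ν s = 1 := by rw [hs, map_div₀, map_pow, map_pow, hU, div_self (pow_pos hνx _).ne']
  have hs0 : s ≠ 0 := fun h => by simp [h] at hsν
  have hx₁0 := hreg.left_ne_zero
  have hx₁1 := hreg.lt_one hdomT
  have hdiv : x₁ * s / x₁ = s := by field_simp
  have hle : ν (x₁ * s) ≤ ν x₁ := by rw [map_mul, hsν, mul_one]
  have hR₁ : quadraticSeq ν R (i + 1) = blowUp ν T s := by
    change quadraticTransform ν T = _
    rw [quadraticTransform_eq hdomT hreg hle, hdiv]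
  have hdom : Dominates ν (blowUp ν T s) := dominates_blowUp hdomT hsν.le
  have hsB : s ∈ blowUp ν T s := mem_blowUp T s
  have hRB : R ≤ blowUp ν T s := hRT.trans (le_blowUp T s)
  have hα : alpha ν P w 1 = resid ν s := by rw [alpha, if_neg hnb, hUe, hP1]
  have hH : IsMonomialChange ν P x₁ s p q k l :=
    ⟨hsν, hx₁0, hx₁1, hP0 ▸ hx, hP1 ▸ hy, hp0, hq0, hpq, by rw [hP0, hP1]⟩
  have htower : towerField ν R P w 1 = baseField ν R ⊔ Subfield.closure {resid ν s} := by
    rw [towerField_succ, towerField_zero, hα]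
  have hbase : baseField ν (blowUp ν T s) = towerField ν R P w 1 := by
    rw [baseField_blowUp hdomT hsν.le, hbT, htower]
  have hdeg : (minpoly (baseField ν R) (resid ν s)).natDegree = d := by
    have h1 : (minpoly (towerField ν R P w 0) (alpha ν P w 1)).natDegree = d :=
      hmin ▸ natDegree_X_pow_add_sum d b
    rw [hα] at h1
    have h2 : ∀ E : Subfield (ResField ν), towerField ν R P w 0 = E →
        (minpoly E (resid ν s)).natDegree = d := by
      rintro _ rfl; exact h1
    exact h2 _ towerField_zero
  have hyq : y ^ q = x ^ p * s := by rw [hs]; field_simp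
  obtain ⟨F, hFm, hFd, hP2⟩ := exists_monic_eq_mul_aeval (T := T) (fun j => hRT (hc j).1)
    (hP0 ▸ hx0) (hP0 ▸ hx1) (by rw [hP0, hP1, hyq]) hsν hq0 (hnd ▸ hPe)
    (fun j => hnd ▸ hσ j 1 le_rfl le_rfl) (hnd ▸ hval) hdvd
  rw [hP0] at hP2
  have hF1 : ν (Polynomial.aeval s F) < 1 := by
    rw [hP2, hP1, hnd, pow_mul (ν y), hU, ← pow_mul, map_mul, map_pow] at hlt
    exact (mul_lt_iff_lt_one_right (pow_pos hνx _)).1 hlt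
  have hregB : IsRegularParameters (blowUp ν T s) x₁ (Polynomial.aeval s F) := by
    -- `T` has the same residue field as `R`, so the class of `s` has degree d = deg F over it, and
    -- no polynomial of smaller degree vanishes residually at `s` unless it is residually zero.
    have := hreg.blowUp hdomT hle F hFm (by rw [hdiv]; exact hF1) (by
      rw [hdiv, hFd]
      intro g hg hg1
      exact hdomT.coeff_lt_one_of_natDegree_lt hbT.le hsν.le g (by rwa [hdeg]) hg1)
    rwa [hdiv] at this
  have hzp : ∀ m : ℤ, s ^ m ∈ blowUp ν T s ∧ (s ^ m)⁻¹ ∈ blowUp ν T s := fun m =>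
    ⟨hdom.zpow_mem hsB hsν m, by rw [← zpow_neg]; exact hdom.zpow_mem hsB hsν _⟩
  have hregQ : IsRegularParameters (blowUp ν T s) x₁ (P 2 / x₁ ^ (p * n 1)) := by
    -- As x = x₁^q s^k, passing from x^(pd) to x₁^(p n_1) costs only the unit s^(kpd).
    have h1 : P 2 / x₁ ^ (p * n 1) = Polynomial.aeval s F * (s ^ k) ^ (p * d) := by
      rw [hP2, hx, hnd, mul_pow, ← pow_mul]
      have : q * (p * d) = p * (q * d) := by ring
      rw [this]
      field_simp
    rw [h1, ← zpow_natCast, ← zpow_mul]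
    exact hregB.mul_right (hzp _).1 (hzp _).2 (zpow_ne_zero _ hs0)
  have hx₁B := hregQ.mem_left
  have hprime := hregQ.isPrime_span.1
  refine ⟨i + 1, ⟨⟨by omega, ?_⟩, ?_⟩, blowUp ν T s, hR₁.symm, hdom,
    hdom.exists_residueField_equiv hbase, x₁, p, hp0, ?_, hregQ, transformW ν P n w p q, ?_⟩
  · rw [hR₁]
    have hxy' : x * y = x₁ ^ (q + p) * s ^ (k + l) := by
      rw [zpow_add₀ hs0, pow_add]
      calc x * y = (x₁ ^ q * s ^ k) * (x₁ ^ p * s ^ l) := by rw [← hx, ← hy]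
        _ = _ := by ring
    rw [hxy']
    exact divisorHasOneComponent hx₁B hprime (by omega) (hzp _).1 (hzp _).2 (zpow_ne_zero _ hs0)
  · rintro j ⟨hj1, hjd⟩
    -- In every ring before `T (i + 1)` the product `x * y` is a monomial divisible by both regular
    -- parameters, hence has two components.
    by_contra hji
    obtain ⟨u, v, a, b, a', b', huv, hxe, hye, h1, h2⟩ := hj j (by omega)
    refine not_divisorHasOneComponent huv h1 h2 ?_
    have : u ^ (a + a') * v ^ (b + b') = x * y := by rw [hxe, hye]; ring
    rwa [this]
  · exact isExceptionalEquation hν hRB hxy hx₁B hprime hq0 hp0 (hzp k).1 (hzp k).2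
      (zpow_ne_zero _ hs0) (hzp l).1 hx hy
  · refine hH.satisfiesAlgorithm_transformSeq hP hν hdom hRB hsB hd hbase hα hdeg hnd hx₁B ?_ hΩ
    have h1 : transformSeq P n x₁ p 1 = P 2 / x₁ ^ (p * n 1) := by
      rw [transformSeq, zero_add, Finset.Icc_self, Finset.prod_singleton]
    rw [h1]
    exact hregQ.mem_right
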